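/- **Setting.** Let $\gamma=\frac{1+\sqrt5}{2}$, $\mathbb T=\mathbb R/2\pi\mathbb Z$, and let $F:\mathbb T^2\to\mathbb R$ be continuous, with Fourier coefficients $F^{[k]}=\frac1{(2\pi)^2}\int_{\mathbb T^2}F(\theta)e^{-ik\cdot\theta}\,d\theta$, $k\in\mathbb Z^2$. Let $r_1,r_2>0$ and assume $$\sup_{k\in\mathbb Z^2}\bigl|F^{[k]}\bigr|e^{r_1|k_1|+r_2|k_2|}<\infty,\tag{1}$$ and that there are $a>0$ and $k_0\in\mathbb N$ such that $$F^{[k]}>a\,e^{-r_1|k_1|-r_2|k_2|}\tag{2}$$ (in particular $F^{[k]}$ is real) for all $k\in\mathbb Z^2$ with $|k_2|>k_0$ for which $|k_1|/|k_2|$ is a continued fraction convergent of $\gamma$. (By (1), $F$ is real-analytic.) For $\alpha\in(0,1)$ and $\varepsilon>0$ the Melnikov function is $$\mathcal M(u,\theta_1,\theta_2;\varepsilon,\alpha)=4\int_{-\infty}^{\infty}\beta(u+s)\,F\Bigl(\theta_1+\frac s\varepsilon,\theta_2+\frac{\gamma s}\varepsilon\Bigr)ds,\qquad \beta(v)=\frac{\sinh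 v\cosh v}{(\cosh^2v-2\alpha\sinh v)^2}.$$ Let $\rho_-=\rho_-(\alpha)$ be the solution of $\sinh\rho_-=\alpha+i\sqrt{1-\alpha^2}$ with $0<\operatorname{Im}\rho_-<\pi/2$. Let $c:\mathbb R\to\mathbb R$ be the $2\ln\gamma$-periodic function with $$c(\delta)=C_0\cosh\Bigl(\frac{\delta-\delta_0}2\Bigr)\ \text{ for }\delta\in[\delta_0-\ln\gamma,\delta_0+\ln\gamma],\qquad C_0=2\sqrt{\frac{\gamma r_1+r_2}{\gamma+\gamma^{-1}}},\quad \delta_0=\ln\frac{\gamma+\gamma^{-1}}{\gamma^2(r_1\gamma+r_2)}.$$ **Corollary 3.2.** Fix $u_0>0$, $C>0$ and $r>0$, and put $\alpha=1-C\varepsilon^r$. Then there are constants $\varepsilon_0,C_1,C_2>0$, independent of $\varepsilon$, such that for all $\varepsilon\in(0,\varepsilon_0)$ the integral defining $\mathcal M$ converges absolutely and the following holds. * If $0<r<2$ and $F$ has zero mean, $F^{[0]}=0$, then $$\frac{C_1}{\sqrt\alpha\,\varepsilon^{1/2+5r/4}}\,e^{-c(\ln(\varepsilon/\operatorname{Im}\rho_-))\sqrt{\operatorname{Im}\rho_-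 /\varepsilon}}\ \le\ \sup_{(u,\theta_1,\theta_2)\in(-u_0,u_0)\times\mathbb T^2}\bigl|\mathcal M(u,\theta_1,\theta_2;\varepsilon,\alpha)\bigr|\ \le\ \frac{C_2}{\sqrt\alpha\,\varepsilon^{1/2+5r/4}}\,e^{-c(\ln(\varepsilon/\operatorname{Im}\rho_-))\sqrt{\operatorname{Im}\rho_- /\varepsilon}}.$$ * If $r\ge2$, then $$\frac{C_1}{\varepsilon^{3r/2}}\ \le\ \sup_{(u,\theta_1,\theta_2)\in(-u_0,u_0)\times\mathbb T^2}\bigl|\mathcal M(u,\theta_1,\theta_2;\varepsilon,\alpha)\bigr|\ \le\ \frac{C_2}{\varepsilon^{3r/2}}.$$ -/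

import Mathlib

open Real MeasureTheory

namespace QPMelnikov

noncomputable section

instance factTwoPiPos : Fact (0 < 2 * π) := ⟨Real.two_pi_pos⟩

/-- The circle `𝕋 = ℝ / 2πℤ`. -/
abbrev Circ : Type := AddCircle (2 * π)

/-- The Fourier coefficient
`F^[k] = (2π)⁻² ∫∫ F(θ₁, θ₂) exp (-i (k₁ θ₁ + k₂ θ₂)) dθ₂ dθ₁` of a function on `𝕋²`. -/
def coeff (F : Circ × Circ → ℝ) (k : ℤ × ℤ) : ℂ :=
  fourierCoeff (fun θ₁ : Circ => fourierCoeff (fun θ₂ : Circ => (F (θ₁, θ₂) : ℂ)) k.2) k.1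

/-- The weight `exp (-r₁ |k₁| - r₂ |k₂|)`. -/
def weight (r₁ r₂ : ℝ) (k : ℤ × ℤ) : ℝ :=
  Real.exp (-r₁ * |(k.1 : ℝ)| - r₂ * |(k.2 : ℝ)|)

/-- `sup_k |F^[k]| exp (r₁ |k₁| + r₂ |k₂|) < ∞`. -/
def CoeffDecay (F : Circ × Circ → ℝ) (r₁ r₂ : ℝ) : Prop :=
  BddAbove (Set.range fun k : ℤ × ℤ => ‖coeff F k‖ / weight r₁ r₂ k)

/-- `F^[k]` is real and `F^[k] > a exp (-r₁ |k₁| - r₂ |k₂|)` for every `k` with `|k₂| > k₀` for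
which `|k₁| / |k₂|` is a continued fraction convergent of the golden mean. -/
def CoeffLower (F : Circ × Circ → ℝ) (r₁ r₂ a : ℝ) (k₀ : ℕ) : Prop :=
  ∀ k : ℤ × ℤ, (k₀ : ℤ) < |k.2| →
    (∃ n : ℕ, |(k.1 : ℝ)| / |(k.2 : ℝ)| = (Real.convergent Real.goldenRatio n : ℝ)) →
    (coeff F k).im = 0 ∧ a * weight r₁ r₂ k < (coeff F k).re

/-- `β(v) = sinh v cosh v / (cosh² v - 2 α sinh v)²`. -/
def beta (α v : ℝ) : ℝ :=
  Real.sinh v * Real.cosh v / (Real.cosh v ^ 2 - 2 * α * Real.sinh v) ^ 2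

/-- The integrand `s ↦ β(u + s) F(θ₁ + s / ε, θ₂ + γ s / ε)`. -/
def integrand (F : Circ × Circ → ℝ) (ε α u : ℝ) (θ : Circ × Circ) (s : ℝ) : ℝ :=
  beta α (u + s) *
    F (θ.1 + ((s / ε : ℝ) : Circ), θ.2 + ((Real.goldenRatio * s / ε : ℝ) : Circ))

/-- The quasiperiodic Melnikov function. -/
def melnikov (F : Circ × Circ → ℝ) (ε α u : ℝ) (θ : Circ × Circ) : ℝ :=
  4 * ∫ s : ℝ, integrand F ε α u θ s

/-- The values of `|M(u, θ₁, θ₂; ε, α)|` for `(u, θ₁, θ₂) ∈ (-u₀, u₀) × 𝕋²`. -/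
def absValues (F : Circ × Circ → ℝ) (ε α u₀ : ℝ) : Set ℝ :=
  {x | ∃ u ∈ Set.Ioo (-u₀) u₀, ∃ θ : Circ × Circ, x = |melnikov F ε α u θ|}

/-- `α + i √(1 - α²)`. -/
def rhoSinh (α : ℝ) : ℂ := ⟨α, √(1 - α ^ 2)⟩

/-- The singularity `ρ₋(α)` of `β`: the solution of `sinh ρ = α + i √(1 - α²)` with
`0 < Im ρ < π / 2`, given by the logarithmic formula for the inverse hyperbolic sine; see
`sinh_rhoMinus`, `rhoMinus_im_mem` and `rhoMinus_unique`. -/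
def rhoMinus (α : ℝ) : ℂ :=
  Complex.log (rhoSinh α + (1 + rhoSinh α ^ 2) ^ (1 / 2 : ℂ))

/-- The square root appearing in `rhoMinus`. -/
lemma rho_sqrt_sq (α : ℝ) :
    ((1 + rhoSinh α ^ 2) ^ (1 / 2 : ℂ)) ^ 2 = 1 + rhoSinh α ^ 2 := by
  have h := Complex.cpow_nat_inv_pow (1 + rhoSinh α ^ 2) (n := 2) (by norm_num)
  rw [one_div]
  exact_mod_cast h

lemma sinh_rhoMinus (α : ℝ) : Complex.sinh (rhoMinus α) = rhoSinh α := by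
  have hw := rho_sqrt_sq α
  set w := (1 + rhoSinh α ^ 2) ^ (1 / 2 : ℂ) with hwdef
  have hprod : (rhoSinh α + w) * (w - rhoSinh α) = 1 := by linear_combination hw
  have hne : rhoSinh α + w ≠ 0 := left_ne_zero_of_mul_eq_one hprod
  have hinv : (rhoSinh α + w)⁻¹ = w - rhoSinh α := inv_eq_of_mul_eq_one_right hprod
  rw [Complex.sinh, rhoMinus, ← hwdef, Complex.exp_neg, Complex.exp_log hne, hinv]
  ring

lemma rhoMinus_im_mem {α : ℝ} (h0 : 0 < α) (h1 : α < 1) :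
    (rhoMinus α).im ∈ Set.Ioo 0 (π / 2) := by
  have hb : 0 < 1 - α ^ 2 := by nlinarith
  have hs : 0 < √(1 - α ^ 2) := Real.sqrt_pos.2 hb
  have hs2 : √(1 - α ^ 2) ^ 2 = 1 - α ^ 2 := Real.sq_sqrt hb.le
  have hw := rho_sqrt_sq α
  have hre : 0 ≤ ((1 + rhoSinh α ^ 2) ^ (1 / 2 : ℂ)).re := by
    have h := Complex.abs_arg_le_pi (1 + rhoSinh α ^ 2)
    rcases eq_or_ne (1 + rhoSinh α ^ 2) 0 with hz | hz
    · rw [hz, Complex.zero_cpow (by norm_num)]; simp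
    · rw [Complex.cpow_def_of_ne_zero hz, Complex.exp_re]
      refine mul_nonneg (Real.exp_pos _).le (Real.cos_nonneg_of_mem_Icc ?_)
      have him : (Complex.log (1 + rhoSinh α ^ 2) * (1 / 2)).im
          = (1 + rhoSinh α ^ 2).arg / 2 := by
        simp [Complex.mul_im, Complex.log_im]; ring
      rw [him]
      rw [abs_le] at h
      constructor <;> linarith [h.1, h.2]
  set w := (1 + rhoSinh α ^ 2) ^ (1 / 2 : ℂ) with hwdef
  have him2 : 2 * (w.re * w.im) = 2 * (α * √(1 - α ^ 2)) := by
    have := congrArg Complex.im hw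
    rw [pow_two, pow_two (rhoSinh α)] at this
    simp only [Complex.mul_im, Complex.add_im, Complex.one_im, rhoSinh] at this
    linarith
  have hprodpos : 0 < w.re * w.im := by
    have := mul_pos h0 hs
    linarith
  have hre' : 0 < w.re := by
    rcases hre.lt_or_eq with h | h
    · exact h
    · rw [← h] at hprodpos; simp at hprodpos
  have him' : 0 < w.im := pos_of_mul_pos_right hprodpos hre
  have hR : 0 < (rhoSinh α + w).re := by
    simp only [Complex.add_re, rhoSinh]; linarith
  have hI : 0 < (rhoSinh α + w).im := by
    simp only [Complex.add_im, rhoSinh]; linarith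
  rw [rhoMinus, ← hwdef, Complex.log_im]
  constructor
  · rcases (Complex.arg_nonneg_iff.2 hI.le).lt_or_eq with h | h
    · exact h
    · exact absurd (Complex.arg_eq_zero_iff.1 h.symm).2 hI.ne'
  · exact lt_of_abs_lt (Complex.abs_arg_lt_pi_div_two_iff.2 (Or.inl hR))

lemma rhoMinus_unique {α : ℝ} (h0 : 0 < α) (h1 : α < 1) {ρ : ℂ}
    (hρ : Complex.sinh ρ = rhoSinh α) (him : ρ.im ∈ Set.Ioo 0 (π / 2)) : ρ = rhoMinus α := by
  have hm := rhoMinus_im_mem h0 h1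
  have hpi := Real.pi_pos
  have h : Complex.sin (ρ * Complex.I) = Complex.sin (rhoMinus α * Complex.I) := by
    rw [Complex.sin_mul_I, Complex.sin_mul_I, hρ, sinh_rhoMinus]
  obtain ⟨k, hk | hk⟩ := Complex.sin_eq_sin_iff.1 h
  · have hre := congrArg Complex.re hk
    have hk' : (2 * (k : ℂ) * π) = ((2 * (k : ℝ) * π : ℝ) : ℂ) := by push_cast; ring
    rw [hk', Complex.add_re, Complex.ofReal_re, Complex.mul_I_re, Complex.mul_I_re] at hre
    have hk0 : k = 0 := by
      have hu : (k : ℝ) < 1 := by nlinarith [him.1, him.2, hm.1, hm.2]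
      have hl : (-1 : ℝ) < k := by nlinarith [him.1, him.2, hm.1, hm.2]
      have hu' : k < 1 := by exact_mod_cast hu
      have hl' : -1 < k := by exact_mod_cast hl
      omega
    rw [hk0] at hk
    refine mul_right_cancel₀ Complex.I_ne_zero ?_
    rw [hk]; simp
  · exfalso
    have hre := congrArg Complex.re hk
    have hk' : ((2 * (k : ℂ) + 1) * π) = (((2 * (k : ℝ) + 1) * π : ℝ) : ℂ) := by push_cast; ring
    rw [hk', Complex.sub_re, Complex.ofReal_re, Complex.mul_I_re, Complex.mul_I_re] at hre
    have hu : (2 * (k : ℝ) + 1) < 1 := by nlinarith [him.1, him.2, hm.1, hm.2]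
    have hl : (-1 : ℝ) < 2 * (k : ℝ) + 1 := by nlinarith [him.1, him.2, hm.1, hm.2]
    have hu' : 2 * k + 1 < 1 := by exact_mod_cast hu
    have hl' : -1 < 2 * k + 1 := by exact_mod_cast hl
    omega

lemma two_log_golden_pos : 0 < 2 * Real.log Real.goldenRatio := by
  have := Real.log_pos Real.one_lt_goldenRatio
  positivity

/-- `C₀ = 2 √((γ r₁ + r₂) / (γ + γ⁻¹))`. -/
def cAmp (r₁ r₂ : ℝ) : ℝ :=
  2 * √((Real.goldenRatio * r₁ + r₂) / (Real.goldenRatio + Real.goldenRatio⁻¹))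

/-- `δ₀ = ln ((γ + γ⁻¹) / (γ² (r₁ γ + r₂)))`. -/
def cShift (r₁ r₂ : ℝ) : ℝ :=
  Real.log ((Real.goldenRatio + Real.goldenRatio⁻¹) /
    (Real.goldenRatio ^ 2 * (r₁ * Real.goldenRatio + r₂)))

/-- The `2 ln γ`-periodic function `c` with `c(δ) = C₀ cosh ((δ - δ₀) / 2)` for
`δ ∈ [δ₀ - ln γ, δ₀ + ln γ]`. -/
def cFun (r₁ r₂ δ : ℝ) : ℝ :=
  cAmp r₁ r₂ * Real.cosh
    ((toIcoMod two_log_golden_pos (cShift r₁ r₂ - Real.log Real.goldenRatio) δ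
      - cShift r₁ r₂) / 2)

/-- The order of magnitude
`α^(-1/2) ε^(-(1/2 + 5r/4)) exp (-c(ln (ε / Im ρ₋)) √(Im ρ₋ / ε))`. -/
def expSmallSize (r₁ r₂ r ε α : ℝ) : ℝ :=
  1 / (√α * ε ^ (1 / 2 + 5 * r / 4)) *
    Real.exp (-cFun r₁ r₂ (Real.log (ε / (rhoMinus α).im)) * √((rhoMinus α).im / ε))

end

end QPMelnikov

/-! Write φ = γ, let ψ be its conjugate, and put η = √(1 - α²) and b = Im ρ₋. Expanding `F` in
characters turns the Melnikov function into a Fourier series in θ whose k-th coefficient has modulus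
4 |F^[k]| |β̂(ν)|, with ν = (k₁ + φ k₂)/ε (`hasSum_melnikov`). Its supremum lies between the largest
such coefficient and the sum of them all, so it remains to estimate β̂ and to locate the dominant k.

For β̂, one integration by parts replaces the double pole of β at ρ₋ by a simple one. Moving the
contour to Im z = π/2 then leaves a residue and a much smaller remainder. Uniformly for small η and
ν ≥ 0, |β̂(ν)| is comparable to (1 + νη) e^{-νb} / η³ (`betaHat_bounds`). Here b is comparable to η,
and η to ε^{r/2}.

If r ≥ 2, then b/ε stays bounded: one fixed resonance already has size η⁻³, and (1 + t) e^{-t} ≤ 1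
gives the matching upper bound.

If r < 2, then p = b/ε tends to infinity, and r₁|k₁| + r₂|k₂| + p|k₁ + φ k₂| must be minimised. Let
x = k₁ + φ k₂ and let x' be its conjugate in ℤ[φ]. Up to O(|x|) the exponent is A|x'| + p|x| with A
= `unitRate`, while |x x'| ≥ 1 because the norm is a nonzero integer. Multiplication by a power φⁿ
balances the two weights to P = Aφⁿ and Q = p/φⁿ, whose ratio lies in [φ⁻¹, φ]. The minimum is then
P + Q, attained at ±1 (`add_le_weighted_size`), and P + Q is exactly c(ln(1/p)) √p
(`exists_zpow_cFun`). The minimiser is a Fibonacci pair, for which the lower bound on F^[k] is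
assumed. All other terms are dominated by a fixed summable family permuted by φⁿ
(`weight_mul_exp_le`), so summing costs only a constant. The prefactor Q/η³ is of order √p/η³, that
is ε^{-1/2-5r/4}. -/

namespace QPMelnikov

/-! ### Arithmetic of ℤ[φ]: norm, units, minimal weighted size -/

open scoped goldenRatio

/-- The frequency `k · (1, φ)`. -/
noncomputable def freq (k : ℤ × ℤ) : ℝ := k.1 + φ * k.2

/-- The algebraic conjugate of `freq k` in `ℤ[φ]`. -/
noncomputable def freqConj (k : ℤ × ℤ) : ℝ := k.1 + ψ * k.2

lemma freq_mul_freqConj (k : ℤ × ℤ) :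
    freq k * freqConj k = ((k.1 ^ 2 + k.1 * k.2 - k.2 ^ 2 : ℤ) : ℝ) := by
  have h1 := goldenRatio_mul_goldenConj
  have h2 := goldenRatio_add_goldenConj
  unfold freq freqConj
  push_cast
  linear_combination (k.1 : ℝ) * k.2 * h2 + (k.2 : ℝ) ^ 2 * h1

lemma freq_ne_zero {k : ℤ × ℤ} (hk : k ≠ 0) : freq k ≠ 0 := by
  intro h
  unfold freq at h
  by_cases h2 : k.2 = 0
  · rw [h2] at h
    apply hk
    ext
    · simpa using h
    · exact h2
  · have h3 : Irrational ((k.2 : ℝ) * φ) := goldenRatio_irrational.intCast_mul h2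
    apply h3
    refine ⟨-k.1, ?_⟩
    push_cast
    linarith

/-- Galois conjugation in `ℤ[φ]`. -/
def conjPair (k : ℤ × ℤ) : ℤ × ℤ := (k.1 + k.2, -k.2)

lemma freq_conjPair (k : ℤ × ℤ) : freq (conjPair k) = freqConj k := by
  have h2 := goldenRatio_add_goldenConj
  unfold freq freqConj conjPair
  push_cast
  linear_combination (-k.2 : ℝ) * h2

lemma freqConj_conjPair (k : ℤ × ℤ) : freqConj (conjPair k) = freq k := by
  have h2 := goldenRatio_add_goldenConj
  unfold freq freqConj conjPair
  push_cast
  linear_combination (-k.2 : ℝ) * h2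

lemma conjPair_ne_zero {k : ℤ × ℤ} (hk : k ≠ 0) : conjPair k ≠ 0 := by
  intro h
  apply hk
  have h1 := congrArg Prod.fst h
  have h2 := congrArg Prod.snd h
  simp only [conjPair, Prod.fst_zero, Prod.snd_zero] at h1 h2
  ext <;> simp <;> omega

lemma freqConj_ne_zero {k : ℤ × ℤ} (hk : k ≠ 0) : freqConj k ≠ 0 := by
  rw [← freq_conjPair]
  exact freq_ne_zero (conjPair_ne_zero hk)

lemma sqrt_five_bounds : 2 < √5 ∧ √5 < 9 / 4 := by
  constructor
  · rw [Real.lt_sqrt (by norm_num)]; norm_num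
  · rw [Real.sqrt_lt' (by norm_num)]; norm_num

lemma fst_eq (k : ℤ × ℤ) : √5 * (k.1 : ℝ) = φ * freqConj k - ψ * freq k := by
  unfold freq freqConj
  linear_combination (-(k.1 : ℝ)) * goldenRatio_sub_goldenConj

lemma snd_eq (k : ℤ × ℤ) : √5 * (k.2 : ℝ) = freq k - freqConj k := by
  unfold freq freqConj
  linear_combination (-(k.2 : ℝ)) * goldenRatio_sub_goldenConj

/-- There is no unit of `ℤ[φ]` whose conjugate lies strictly between `1` and `φ`. -/
lemma goldenRatio_le_abs_freqConj {k : ℤ × ℤ} (hn : |freq k| * |freqConj k| = 1)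
    (h1 : 1 < |freqConj k|) : φ ≤ |freqConj k| := by
  by_contra! h2
  obtain ⟨h5l, h5u⟩ := sqrt_five_bounds
  have hx : |freq k| < 1 := by
    by_contra! h
    nlinarith
  have hφ : φ < 13 / 8 := by unfold goldenRatio; linarith
  have hφ' : 3 / 2 < φ := by unfold goldenRatio; linarith
  -- The trace x + x' and the difference x - x' = √5 k₂ are now bounded, so only finitely many pairs
  -- remain to be checked.
  have e1 : (2 * k.1 + k.2 : ℝ) = freq k + freqConj k := by
    have h2 := goldenRatio_add_goldenConj
    unfold freq freqConj
    linear_combination (-k.2 : ℝ) * h2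
  have e2 := snd_eq k
  obtain ⟨a1, a2⟩ := abs_lt.1 hx
  obtain ⟨b1, b2⟩ := abs_lt.1 h2
  have c1 : (k.2 : ℝ) < 2 := by nlinarith
  have c2 : (-2 : ℝ) < k.2 := by nlinarith
  have c3 : (2 * k.1 + k.2 : ℝ) < 3 := by linarith
  have c4 : (-3 : ℝ) < 2 * k.1 + k.2 := by linarith
  have d1 : k.2 < 2 := by exact_mod_cast c1
  have d2 : -2 < k.2 := by exact_mod_cast c2
  have d3 : 2 * k.1 + k.2 < 3 := by exact_mod_cast c3
  have d4 : -3 < 2 * k.1 + k.2 := by exact_mod_cast c4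
  have hψ : ψ = 1 - φ := by linarith [goldenRatio_add_goldenConj]
  obtain ⟨m, n⟩ := k
  simp only at d1 d2 d3 d4
  have d5 : m < 2 := by omega
  have d6 : -2 < m := by omega
  unfold freqConj at h1 h2
  rw [hψ] at h1 h2
  simp only at h1 h2
  rcases lt_abs.1 h1 with h1 | h1 <;> rw [abs_lt] at h2 <;> obtain ⟨h2, h3⟩ := h2 <;>
  interval_cases n <;> interval_cases m <;> first | omega | (push_cast at h1 h2 h3; linarith)

lemma goldenRatio_le_abs_freq {k : ℤ × ℤ} (hn : |freq k| * |freqConj k| = 1)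
    (h1 : 1 < |freq k|) : φ ≤ |freq k| := by
  rw [← freqConj_conjPair] at h1 ⊢
  apply goldenRatio_le_abs_freqConj _ h1
  rw [freq_conjPair, freqConj_conjPair, mul_comm]
  exact hn

/-- Among the nonzero elements of `ℤ[φ]`, the weighted size `P |x'| + Q |x|` is minimal at `±1`
as long as `P / Q` lies between `φ⁻¹` and `φ`. -/
lemma add_le_weighted_size {P Q : ℝ} (hP : 0 < P) (hQ : 0 < Q) (hPQ : P ≤ φ * Q)
    (hQP : Q ≤ φ * P) {k : ℤ × ℤ} (hk : k ≠ 0) :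
    P + Q ≤ P * |freqConj k| + Q * |freq k| := by
  have hx := abs_pos.2 (freq_ne_zero hk)
  have hy := abs_pos.2 (freqConj_ne_zero hk)
  have hxy : |freq k| * |freqConj k| = ((|k.1 ^ 2 + k.1 * k.2 - k.2 ^ 2| : ℤ) : ℝ) := by
    rw [← abs_mul, freq_mul_freqConj, Int.cast_abs]
  have hN : 1 ≤ |k.1 ^ 2 + k.1 * k.2 - k.2 ^ 2| := by
    have : (0 : ℝ) < ((|k.1 ^ 2 + k.1 * k.2 - k.2 ^ 2| : ℤ) : ℝ) := by
      rw [← hxy]; positivity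
    have : 0 < |k.1 ^ 2 + k.1 * k.2 - k.2 ^ 2| := by exact_mod_cast this
    omega
  have hφ := goldenRatio_lt_two
  have hφ1 := one_lt_goldenRatio
  rcases hN.eq_or_lt with h | h
  · rw [← h, Int.cast_one] at hxy
    set x := |freq k|
    set y := |freqConj k|
    rcases lt_trichotomy y 1 with h1 | h1 | h1
    · have hx1 : 1 < x := by
        by_contra! h; nlinarith
      have := goldenRatio_le_abs_freq hxy hx1
      have h3 : P ≤ Q * x := by nlinarith
      -- For xy = 1 the excess over P + Q factors. The second factor is nonnegative because a unit
      -- with x > 1 has x ≥ φ ≥ P/Q.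
      have : P * y + Q * x - (P + Q) = (1 - y) * (Q * x - P) := by
        linear_combination Q * hxy
      nlinarith
    · rw [h1] at hxy ⊢
      nlinarith
    · have := goldenRatio_le_abs_freqConj hxy h1
      have hx1 : x < 1 := by
        by_contra! h; nlinarith
      have h3 : Q ≤ P * y := by nlinarith
      have : P * y + Q * x - (P + Q) = (1 - x) * (P * y - Q) := by
        linear_combination P * hxy
      nlinarith
  · have h2 : (2 : ℝ) ≤ |freq k| * |freqConj k| := by
      rw [hxy]; exact_mod_cast h
    set x := |freq k|
    set y := |freqConj k|
    apply abs_le_of_sq_le_sq' _ (by positivity) |>.2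
    -- When the norm is at least 2, balance gives (P + Q)² ≤ 5PQ, while AM-GM gives (Py + Qx)² ≥
    -- 4PQxy ≥ 8PQ.
    have e1 : (P - Q) ^ 2 ≤ P * Q := by
      rcases le_total P Q with h | h <;> nlinarith
    have : P * Q * 2 ≤ P * Q * (x * y) := by gcongr
    nlinarith [sq_nonneg (P * y - Q * x)]

/-- Multiplication by `φ` in `ℤ[φ]`. -/
def goldenMul : Equiv.Perm (ℤ × ℤ) where
  toFun k := (k.2, k.1 + k.2)
  invFun k := (k.2 - k.1, k.1)
  left_inv k := by ext <;> simp
  right_inv k := by ext <;> simp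

lemma freq_goldenMul (k : ℤ × ℤ) : freq (goldenMul k) = φ * freq k := by
  have := goldenRatio_sq
  simp only [freq, goldenMul, Equiv.coe_fn_mk]
  push_cast
  linear_combination (-(k.2 : ℝ)) * this

lemma freqConj_goldenMul (k : ℤ × ℤ) : freqConj (goldenMul k) = ψ * freqConj k := by
  have := goldenConj_sq
  simp only [freqConj, goldenMul, Equiv.coe_fn_mk]
  push_cast
  linear_combination (-(k.2 : ℝ)) * this

lemma abs_freq_goldenMul_zpow (n : ℤ) (k : ℤ × ℤ) :
    |freq ((goldenMul ^ n) k)| = φ ^ n * |freq k| := by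
  have hφ := goldenRatio_pos
  have key : ∀ k, |freq (goldenMul k)| = φ * |freq k| := fun k => by
    rw [freq_goldenMul, abs_mul, abs_of_pos hφ]
  induction n generalizing k with
  | zero => simp
  | succ n ih =>
    rw [zpow_add_one, Equiv.Perm.mul_apply, ih, key, zpow_add_one₀ hφ.ne']
    ring
  | pred n ih =>
    rw [zpow_sub_one, Equiv.Perm.mul_apply, ih, zpow_sub_one₀ hφ.ne']
    have := key (goldenMul⁻¹ k)
    rw [← Equiv.Perm.mul_apply, mul_inv_cancel, Equiv.Perm.one_apply] at this
    rw [this]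
    field_simp

lemma abs_freqConj_goldenMul_zpow (n : ℤ) (k : ℤ × ℤ) :
    |freqConj ((goldenMul ^ n) k)| = φ ^ (-n) * |freqConj k| := by
  have hφ := goldenRatio_pos
  have key : ∀ k, |freqConj (goldenMul k)| = φ⁻¹ * |freqConj k| := fun k => by
    rw [freqConj_goldenMul, abs_mul, inv_goldenRatio, abs_of_neg goldenConj_neg]
  induction n generalizing k with
  | zero => simp
  | succ n ih =>
    rw [zpow_add_one, Equiv.Perm.mul_apply, ih, key, neg_add, zpow_add₀ hφ.ne', zpow_neg_one]
    ring
  | pred n ih =>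
    rw [zpow_sub_one, Equiv.Perm.mul_apply, ih]
    have := key (goldenMul⁻¹ k)
    rw [← Equiv.Perm.mul_apply, mul_inv_cancel, Equiv.Perm.one_apply] at this
    rw [this, neg_sub, sub_eq_add_neg, zpow_add₀ hφ.ne', zpow_one]
    field_simp

/-! ### Fourier weights in the coordinates x, x', and the Fibonacci resonances -/

lemma summable_exp_neg_mul_abs {c : ℝ} (hc : 0 < c) :
    Summable fun n : ℤ => Real.exp (-c * |(n : ℝ)|) := by
  have h : Summable fun n : ℕ => Real.exp (-c * n) := by
    have := Real.summable_exp_nat_mul_iff (a := -c)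
    simp only [mul_comm] at this ⊢
    exact this.2 (by linarith)
  apply Summable.of_nat_of_neg
  · simpa using h
  · simpa using h

lemma abs_fst_le (k : ℤ × ℤ) : |(k.1 : ℝ)| ≤ |freqConj k| + |freq k| := by
  have h5 := sqrt_five_bounds.1
  have h := congrArg abs (fst_eq k)
  rw [abs_mul, abs_of_pos (by linarith)] at h
  have h1 := abs_sub (φ * freqConj k) (ψ * freq k)
  rw [abs_mul, abs_mul, abs_of_pos goldenRatio_pos, abs_of_neg goldenConj_neg] at h1
  have := goldenRatio_lt_two
  have := neg_one_lt_goldenConj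
  nlinarith [abs_nonneg (freq k), abs_nonneg (freqConj k), abs_nonneg (k.1 : ℝ)]

lemma abs_snd_le (k : ℤ × ℤ) : |(k.2 : ℝ)| ≤ |freqConj k| + |freq k| := by
  have h5 := sqrt_five_bounds.1
  have h := congrArg abs (snd_eq k)
  rw [abs_mul, abs_of_pos (by linarith)] at h
  have h1 := abs_sub (freq k) (freqConj k)
  nlinarith [abs_nonneg (freq k), abs_nonneg (freqConj k), abs_nonneg (k.2 : ℝ)]

lemma summable_exp_abs_add_abs {c : ℝ} (hc : 0 < c) :
    Summable fun k : ℤ × ℤ => Real.exp (-c * |(k.1 : ℝ)|) * Real.exp (-c * |(k.2 : ℝ)|) :=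
  (summable_exp_neg_mul_abs hc).mul_of_nonneg (summable_exp_neg_mul_abs hc)
    (fun _ => (Real.exp_pos _).le) (fun _ => (Real.exp_pos _).le)

/-- Both |k₁| and |k₂| are at most |x| + |x'|, so half of the rate goes to each coordinate of a
product of geometric series. -/
lemma summable_exp_size {c : ℝ} (hc : 0 < c) :
    Summable fun k : ℤ × ℤ => Real.exp (-c * (|freqConj k| + |freq k|)) := by
  refine Summable.of_nonneg_of_le (fun _ => (Real.exp_pos _).le) (fun k => ?_)
    (summable_exp_abs_add_abs (c := c / 2) (by linarith))
  rw [← Real.exp_add, Real.exp_le_exp]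
  nlinarith [abs_fst_le k, abs_snd_le k]

/-- The growth rate of `r₁ |k₁| + r₂ |k₂|` along units of `ℤ[φ]`. -/
noncomputable def unitRate (r₁ r₂ : ℝ) : ℝ := (r₁ * φ + r₂) / √5

lemma unitRate_pos {r₁ r₂ : ℝ} (hr₁ : 0 < r₁) (hr₂ : 0 < r₂) : 0 < unitRate r₁ r₂ := by
  have := goldenRatio_pos
  unfold unitRate
  positivity

/-- Since √5 k₁ = φx' - ψx and √5 k₂ = x - x', the absolute values √5|k₁| and √5|k₂| differ from
φ|x'| and |x'| by at most |x|. Near the resonances x is small, so the weight depends essentially on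
|x'| alone. -/
lemma abs_weight_exponent {r₁ r₂ : ℝ} (hr₁ : 0 < r₁) (hr₂ : 0 < r₂) (k : ℤ × ℤ) :
    |r₁ * |(k.1 : ℝ)| + r₂ * |(k.2 : ℝ)| - unitRate r₁ r₂ * (|freqConj k|)|
      ≤ (r₁ + r₂) * |freq k| := by
  have h5 := sqrt_five_bounds.1
  have e1 := abs_abs_sub_abs_le (√5 * (k.1 : ℝ)) (φ * freqConj k)
  have e2 := abs_abs_sub_abs_le (√5 * (k.2 : ℝ)) (- freqConj k)
  rw [fst_eq, sub_sub_cancel_left, abs_neg, abs_mul ψ, abs_of_neg goldenConj_neg, ← fst_eq,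
    abs_mul, abs_of_pos (by linarith : 0 < √5), abs_mul, abs_of_pos goldenRatio_pos] at e1
  rw [snd_eq, sub_neg_eq_add, sub_add_cancel, ← snd_eq, abs_neg,
    abs_mul, abs_of_pos (by linarith : 0 < √5)] at e2
  have := neg_one_lt_goldenConj
  have hx := abs_nonneg (freq k)
  have e3 : r₁ * |(k.1 : ℝ)| + r₂ * |(k.2 : ℝ)| - unitRate r₁ r₂ * |freqConj k|
      = (r₁ * (√5 * |(k.1 : ℝ)| - φ * |freqConj k|) + r₂ * (√5 * |(k.2 : ℝ)| - |freqConj k|)) / √5 := by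
    unfold unitRate
    field_simp
    ring
  rw [e3, abs_div, abs_of_pos (by linarith : 0 < √5), div_le_iff₀ (by linarith)]
  refine (abs_add_le _ _).trans ?_
  rw [abs_mul, abs_mul, abs_of_pos hr₁, abs_of_pos hr₂]
  have e4 : -ψ * |freq k| ≤ |freq k| := by nlinarith
  calc _ ≤ r₁ * |freq k| + r₂ * |freq k| :=
        add_le_add (mul_le_mul_of_nonneg_left (e1.trans e4) hr₁.le)
          (mul_le_mul_of_nonneg_left e2 hr₂.le)
    _ = (r₁ + r₂) * |freq k| * 1 := by ring
    _ ≤ _ := by gcongr; linarith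

/-- Near-optimal scales dominate: each term is controlled by the optimal exponential times a fixed
summable family, evaluated after multiplication by a unit. -/
lemma weight_mul_exp_le {r₁ r₂ : ℝ} (hr₁ : 0 < r₁) (hr₂ : 0 < r₂) {P Q p X : ℝ} {n : ℤ}
    (hX : X = φ ^ n) (hP : P = unitRate r₁ r₂ * X) (hQ : p = Q * X) (hQ1 : 1 ≤ Q)
    (hPQ : P ≤ φ * Q) (hQP : Q ≤ φ * P) (hXl : 8 * (r₁ + r₂) ≤ X) {k : ℤ × ℤ} (hk : k ≠ 0) :
    weight r₁ r₂ k * ((1 + p * |freq k|) * Real.exp (-(p * |freq k|))) ≤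
      8 * Real.exp 3 * Q * Real.exp (-(P + Q)) *
        Real.exp (-(1 / 2) * (|freqConj ((goldenMul ^ n) k)| + |freq ((goldenMul ^ n) k)|)) := by
  have hφ := goldenRatio_pos
  have hφ2 := goldenRatio_lt_two
  have hX0 : 0 < X := hX ▸ zpow_pos hφ n
  have hA := unitRate_pos hr₁ hr₂
  have hP0 : 0 < P := hP ▸ mul_pos hA hX0
  set x := |freq ((goldenMul ^ n) k)| with hx
  set y := |freqConj ((goldenMul ^ n) k)| with hy
  have hx' : |freq k| = x / X := by
    rw [hx, abs_freq_goldenMul_zpow, ← hX]; field_simp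
  have hy' : |freqConj k| = X * y := by
    rw [hy, abs_freqConj_goldenMul_zpow, zpow_neg, ← hX]; field_simp
  have hk' : (goldenMul ^ n) k ≠ 0 := by
    intro h
    rw [h] at hx
    have : |freq k| = 0 := by rw [hx', hx]; simp [freq]
    exact freq_ne_zero hk (abs_eq_zero.1 this)
  have hx0 : 0 ≤ x := abs_nonneg _
  have hy0 : 0 ≤ y := abs_nonneg _
  -- Dividing by Q makes the gain over the minimum a nonnegative quantity multiplied by Q ≥ 1, so
  -- this factor can be dropped below.
  have hmin : P / Q + 1 ≤ P / Q * y + 1 * x := by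
    apply add_le_weighted_size (by positivity) one_pos _ _ hk'
    · rw [div_le_iff₀ (by linarith)]; linarith
    · rw [mul_div_assoc', le_div_iff₀ (by linarith)]; linarith
  have hratio : 1 / 2 ≤ P / Q := by
    rw [div_le_div_iff₀ (by norm_num) (by linarith)]; nlinarith
  have hratio2 : P / Q ≤ 2 := by
    rw [div_le_iff₀ (by linarith)]; nlinarith
  have hgain : P * y + Q * x - (P + Q) ≥ (1 / 2) * y + x - 3 := by
    have e : P * y + Q * x - (P + Q) = Q * (P / Q * y + 1 * x - (P / Q + 1)) := by
      field_simp
    rw [e]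
    calc _ ≥ P / Q * y + 1 * x - (P / Q + 1) := by nlinarith
      _ ≥ _ := by nlinarith
  have hw := (abs_le.1 (abs_weight_exponent hr₁ hr₂ k)).1
  rw [hx', hy', show unitRate r₁ r₂ * (X * y) = P * y by rw [hP]; ring] at hw
  have hpx : p * |freq k| = Q * x := by rw [hx', hQ]; field_simp
  rw [hpx]
  -- The error in the weight costs x/8 because X ≥ 8(r₁ + r₂), and the factor 1 + Qx costs another
  -- x/8. The gain y/2 + x - 3 absorbs both and leaves (x + y)/2 - 3.
  have hdx : (r₁ + r₂) * (x / X) ≤ x / 8 := by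
    rw [mul_div_assoc', div_le_div_iff₀ hX0 (by norm_num)]
    nlinarith
  have h1 : 1 + Q * x ≤ 8 * Q * Real.exp (x / 8) := by
    have := Real.add_one_le_exp (x / 8)
    nlinarith
  calc weight r₁ r₂ k * ((1 + Q * x) * Real.exp (-(Q * x)))
      ≤ Real.exp (-(P * y) + x / 8) * ((8 * Q * Real.exp (x / 8)) * Real.exp (-(Q * x))) := by
        unfold weight
        gcongr
        linarith
    _ = 8 * Q * Real.exp (-(P * y + Q * x) + x / 4) := by
        have : -(P * y + Q * x) + x / 4 = (-(P * y) + x / 8) + x / 8 + -(Q * x) := by ring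
        rw [this, Real.exp_add (-(P * y) + x / 8 + x / 8), Real.exp_add (-(P * y) + x / 8)]; ring
    _ ≤ 8 * Q * Real.exp (3 + -(P + Q) + -(1 / 2) * (y + x)) :=
        mul_le_mul_of_nonneg_left (Real.exp_le_exp.2 (by linarith)) (by linarith)
    _ = _ := by
        rw [Real.exp_add, Real.exp_add]; ring

lemma summable_weight {r₁ r₂ : ℝ} (hr₁ : 0 < r₁) (hr₂ : 0 < r₂) : Summable (weight r₁ r₂) := by
  refine Summable.of_nonneg_of_le (fun _ => (Real.exp_pos _).le) (fun k => ?_)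
    (summable_exp_abs_add_abs (c := min r₁ r₂) (lt_min hr₁ hr₂))
  unfold weight
  rw [← Real.exp_add, Real.exp_le_exp]
  have := mul_le_mul_of_nonneg_right (min_le_left r₁ r₂) (abs_nonneg (k.1 : ℝ))
  have := mul_le_mul_of_nonneg_right (min_le_right r₁ r₂) (abs_nonneg (k.2 : ℝ))
  linarith

/-- The inverse of the fractional part of φ is φ again, so every partial quotient is 1 and the
recursion is that of Fibonacci. -/
lemma convergent_goldenRatio (n : ℕ) :
    Real.convergent φ n = (Nat.fib (n + 2) : ℚ) / Nat.fib (n + 1) := by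
  have hfl : ⌊φ⌋ = 1 := by
    rw [Int.floor_eq_iff]
    have := one_lt_goldenRatio
    have := goldenRatio_lt_two
    push_cast
    constructor <;> linarith
  induction n with
  | zero => simp [hfl]
  | succ n ih =>
    have : (Int.fract φ)⁻¹ = φ := by
      rw [Int.fract, hfl, Int.cast_one, ← inv_inv φ, inv_goldenRatio, inv_inj]
      linarith [goldenRatio_add_goldenConj, inv_goldenConj, inv_neg (a := ψ)]
    rw [Real.convergent_succ, this, ih, hfl, Nat.fib_add_two (n := n + 1)]
    have : (Nat.fib (n + 2) : ℚ) ≠ 0 := by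
      exact_mod_cast (Nat.fib_pos.2 (by omega)).ne'
    push_cast
    field_simp
    ring

/-- The pair represents the unit -ψⁿ, with conjugate -φⁿ. These are the resonances at which the
minimum of the exponent is reached. -/
lemma abs_freq_fib (n : ℕ) : |freq (-(Nat.fib (n + 1) : ℤ), (Nat.fib n : ℤ))| = (φ ^ n)⁻¹ := by
  have := fib_succ_sub_goldenRatio_mul_fib n
  have e : freq (-(Nat.fib (n + 1) : ℤ), (Nat.fib n : ℤ)) = - ψ ^ n := by
    unfold freq; push_cast; linarith
  rw [e, abs_neg, abs_pow, abs_of_neg goldenConj_neg, ← inv_goldenRatio, inv_pow]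

lemma abs_freqConj_fib (n : ℕ) : |freqConj (-(Nat.fib (n + 1) : ℤ), (Nat.fib n : ℤ))| = φ ^ n := by
  have := fib_succ_sub_goldenConj_mul_fib n
  have e : freqConj (-(Nat.fib (n + 1) : ℤ), (Nat.fib n : ℤ)) = - φ ^ n := by
    unfold freqConj; push_cast; linarith
  rw [e, abs_neg, abs_pow, abs_of_pos goldenRatio_pos]

lemma weight_fib_ge {r₁ r₂ : ℝ} (hr₁ : 0 < r₁) (hr₂ : 0 < r₂) (n : ℕ) :
    Real.exp (-(r₁ + r₂)) * Real.exp (-(unitRate r₁ r₂ * φ ^ n)) ≤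
      weight r₁ r₂ (-(Nat.fib (n + 1) : ℤ), (Nat.fib n : ℤ)) := by
  have h := (abs_le.1 (abs_weight_exponent hr₁ hr₂ (-(Nat.fib (n + 1) : ℤ), (Nat.fib n : ℤ)))).2
  rw [abs_freq_fib, abs_freqConj_fib] at h
  have h1 : (φ ^ n)⁻¹ ≤ 1 := inv_le_one_of_one_le₀ (one_le_pow₀ one_lt_goldenRatio.le)
  unfold weight
  rw [← Real.exp_add, Real.exp_le_exp]
  nlinarith

end QPMelnikov

/-! ### Contour shift across a simple pole -/

namespace QPMelnikov
open Filter Topology Set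

lemma integral_div_sq_add_sq {c : ℝ} (hc : c ≠ 0) :
    Integrable (fun x : ℝ => c / (x ^ 2 + c ^ 2)) ∧ ∫ x : ℝ, c / (x ^ 2 + c ^ 2) = |c| / c * π := by
  have e : (fun x : ℝ => c / (x ^ 2 + c ^ 2)) = fun x => c⁻¹ * (1 + (x / c) ^ 2)⁻¹ := by
    ext x
    have : x ^ 2 + c ^ 2 ≠ 0 := by positivity
    have : 1 + (x / c) ^ 2 ≠ 0 := by positivity
    field_simp
    ring
  rw [e]
  constructor
  · exact (integrable_inv_one_add_sq.comp_div hc).const_mul _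
  · rw [integral_const_mul, Measure.integral_comp_div (fun x : ℝ => (1 + x ^ 2)⁻¹),
      integral_univ_inv_one_add_sq, smul_eq_mul]
    ring

lemma integral_odd_eq_zero {f : ℝ → ℝ} (hf : ∀ x, f (-x) = -f x) : ∫ x, f x = 0 := by
  have h := integral_neg_eq_self f volume
  simp only [hf, integral_neg] at h
  linarith

lemma inv_sub_mul_I {c : ℝ} (hc : c ≠ 0) (x : ℝ) :
    ((x : ℂ) - c * Complex.I)⁻¹
      = ((x / (x ^ 2 + c ^ 2) : ℝ) : ℂ) + ((c / (x ^ 2 + c ^ 2) : ℝ) : ℂ) * Complex.I := by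
  have h1 : x ^ 2 + c ^ 2 ≠ 0 := by positivity
  have h2 : ((x : ℂ) ^ 2 + c ^ 2) ≠ 0 := by exact_mod_cast h1
  rw [inv_eq_iff_eq_inv, eq_comm, inv_eq_of_mul_eq_one_right]
  push_cast
  field_simp
  linear_combination (-(c : ℂ) ^ 2) * Complex.I_sq

/-- A single simple pole is not integrable on the line, but a difference of two is. Its real part is
odd and integrates to zero; its imaginary part is a difference of Cauchy densities. -/
lemma integral_inv_sub_inv {c d : ℝ} (hc : c ≠ 0) (hd : d ≠ 0) :
    Integrable (fun x : ℝ => ((x : ℂ) - c * Complex.I)⁻¹ - ((x : ℂ) - d * Complex.I)⁻¹) ∧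
    ∫ x : ℝ, (((x : ℂ) - c * Complex.I)⁻¹ - ((x : ℂ) - d * Complex.I)⁻¹)
      = ((|c| / c - |d| / d : ℝ) : ℂ) * π * Complex.I := by
  obtain ⟨i1, e1⟩ := integral_div_sq_add_sq hc
  obtain ⟨i2, e2⟩ := integral_div_sq_add_sq hd
  set f : ℝ → ℝ := fun x => x / (x ^ 2 + c ^ 2) - x / (x ^ 2 + d ^ 2) with hf
  have hfo : ∫ x, f x = 0 := integral_odd_eq_zero fun x => by simp only [hf]; ring
  have hc2 : 0 < c ^ 2 := by positivity
  have hd2 : 0 < d ^ 2 := by positivity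
  have hfi : Integrable f := by
    -- The majorant comes from 2|c||x| ≤ x² + c².
    refine Integrable.mono' (i2.const_mul (|d ^ 2 - c ^ 2| / (2 * |c|) / d)) ?_
      (ae_of_all _ fun x => ?_)
    · apply Continuous.aestronglyMeasurable
      simp only [hf]
      fun_prop (disch := intro; positivity)
    · simp only [hf, Real.norm_eq_abs]
      have e : x / (x ^ 2 + c ^ 2) - x / (x ^ 2 + d ^ 2)
          = (d ^ 2 - c ^ 2) * (x / ((x ^ 2 + c ^ 2) * (x ^ 2 + d ^ 2))) := by
        field_simp
        ring
      rw [e, abs_mul, abs_div, abs_of_pos (by positivity : 0 < (x ^ 2 + c ^ 2) * (x ^ 2 + d ^ 2))]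
      have hc' := abs_pos.2 hc
      have e2 : |d ^ 2 - c ^ 2| / (2 * |c|) / d * (d / (x ^ 2 + d ^ 2))
          = |d ^ 2 - c ^ 2| * (1 / (2 * |c| * (x ^ 2 + d ^ 2))) := by
        field_simp
      rw [e2]
      refine mul_le_mul_of_nonneg_left ?_ (abs_nonneg _)
      rw [div_le_div_iff₀ (by positivity) (by positivity), one_mul, mul_comm (2 * |c|),
        ← mul_assoc, mul_comm |x|, mul_assoc, mul_comm (x ^ 2 + c ^ 2)]
      refine mul_le_mul_of_nonneg_left ?_ (by positivity)
      nlinarith [sq_nonneg (|x| - |c|), sq_abs x, sq_abs c]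
  have key : ∀ x : ℝ, ((x : ℂ) - c * Complex.I)⁻¹ - ((x : ℂ) - d * Complex.I)⁻¹
      = (f x : ℂ) + ((c / (x ^ 2 + c ^ 2) - d / (x ^ 2 + d ^ 2) : ℝ) : ℂ) * Complex.I := by
    intro x
    rw [inv_sub_mul_I hc, inv_sub_mul_I hd]
    simp only [hf]
    push_cast
    ring
  simp_rw [key]
  have j1 : Integrable fun x => (f x : ℂ) := hfi.ofReal
  have j2 : Integrable fun x : ℝ =>
      ((c / (x ^ 2 + c ^ 2) - d / (x ^ 2 + d ^ 2) : ℝ) : ℂ) * Complex.I :=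
    ((i1.sub i2).ofReal (𝕜 := ℂ)).mul_const Complex.I
  refine ⟨j1.add j2, ?_⟩
  rw [integral_add j1 j2, integral_mul_const, integral_complex_ofReal, integral_complex_ofReal, hfo,
    integral_sub i1 i2, e1, e2]
  push_cast
  ring

lemma integral_inv_sub_inv_shift {ρ τ : ℂ} {h : ℝ} (hρ : ρ.im ≠ h) (hτ : τ.im ≠ h)
    (hre : ρ.re = τ.re) :
    Integrable (fun x : ℝ => ((x : ℂ) + h * Complex.I - ρ)⁻¹ - ((x : ℂ) + h * Complex.I - τ)⁻¹) ∧
    ∫ x : ℝ, (((x : ℂ) + h * Complex.I - ρ)⁻¹ - ((x : ℂ) + h * Complex.I - τ)⁻¹)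
      = ((|ρ.im - h| / (ρ.im - h) - |τ.im - h| / (τ.im - h) : ℝ) : ℂ) * π * Complex.I := by
  obtain ⟨h1, h2⟩ := integral_inv_sub_inv (sub_ne_zero.2 hρ) (sub_ne_zero.2 hτ)
  have e : (fun x : ℝ => ((x : ℂ) + h * Complex.I - ρ)⁻¹ - ((x : ℂ) + h * Complex.I - τ)⁻¹)
      = fun x : ℝ => (fun x : ℝ => ((x : ℂ) - (ρ.im - h : ℝ) * Complex.I)⁻¹
          - ((x : ℂ) - (τ.im - h : ℝ) * Complex.I)⁻¹) (x - ρ.re) := by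
    ext x
    have e1 : ρ = ρ.re + ρ.im * Complex.I := (Complex.re_add_im ρ).symm
    have e2 : τ = ρ.re + τ.im * Complex.I := by rw [hre]; exact (Complex.re_add_im τ).symm
    simp only
    congr 2
    · conv_lhs => rw [e1]
      push_cast; ring
    · conv_lhs => rw [e2]
      push_cast; ring
  rw [e]
  exact ⟨h1.comp_sub_right _, (integral_sub_right_eq_self _ _).trans h2⟩

lemma norm_inv_sub_le {z ρ : ℂ} {R : ℝ} (h : |ρ.re| < R) (hz : |z.re| = R) :
    ‖(z - ρ)⁻¹‖ ≤ (R - |ρ.re|)⁻¹ := by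
  rw [norm_inv]
  apply inv_anti₀ (by linarith)
  calc R - |ρ.re| ≤ |z.re - ρ.re| := by
        rw [← hz]; exact abs_sub_abs_le_abs_sub _ _
    _ = |(z - ρ).re| := by rw [Complex.sub_re]
    _ ≤ _ := Complex.abs_re_le_norm _

/-- Shifting a contour across a simple pole in a horizontal strip. -/
lemma integral_sub_integral_shift {N : ℂ → ℂ} {ρ : ℂ} {h : ℝ} (h0 : 0 < ρ.im) (h1 : ρ.im < h)
    (hN : ∀ z : ℂ, 0 ≤ z.im → z.im ≤ h → DifferentiableAt ℂ N z)
    {g : ℝ → ℝ} (hg : Tendsto g atTop (𝓝 0))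
    (hgN : ∀ᶠ R in atTop, ∀ z : ℂ, 0 ≤ z.im → z.im ≤ h → |z.re| = R → ‖N z * (z - ρ)⁻¹‖ ≤ g R)
    (i1 : Integrable fun x : ℝ => N x * ((x : ℂ) - ρ)⁻¹)
    (i2 : Integrable fun x : ℝ => N (x + h * Complex.I) * ((x : ℂ) + h * Complex.I - ρ)⁻¹) :
    ∫ x : ℝ, N x * ((x : ℂ) - ρ)⁻¹
      = 2 * π * Complex.I * N ρ +
        ∫ x : ℝ, N (x + h * Complex.I) * ((x : ℂ) + h * Complex.I - ρ)⁻¹ := by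
  -- The conjugate pole lies outside the strip. Subtracting N(ρ)((z-ρ)⁻¹ - (z-τ)⁻¹) removes the
  -- singularity and keeps integrability on both lines.
  set τ : ℂ := (starRingEnd ℂ) ρ with hτ
  have hτim : τ.im = -ρ.im := Complex.conj_im ρ
  have hτre : τ.re = ρ.re := Complex.conj_re ρ
  have j1 := integral_inv_sub_inv_shift (ρ := ρ) (τ := τ) (h := 0) h0.ne' (by linarith) hτre.symm
  have j2 := integral_inv_sub_inv_shift (ρ := ρ) (τ := τ) (h := h) (by linarith) (by linarith)
    hτre.symm
  -- The lower line separates ρ from τ, which produces 2πi. Both poles lie below the upper line, so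
  -- nothing arises there.
  have s1 : |ρ.im - 0| / (ρ.im - 0) - |τ.im - 0| / (τ.im - 0) = 2 := by
    rw [hτim, sub_zero, sub_zero, abs_neg, abs_of_pos h0]; field_simp; norm_num
  have s2 : |ρ.im - h| / (ρ.im - h) - |τ.im - h| / (τ.im - h) = 0 := by
    rw [abs_of_neg (by linarith), abs_of_neg (by linarith), neg_div, neg_div,
      div_self (by linarith), div_self (by linarith)]; ring
  rw [s1] at j1
  rw [s2] at j2
  simp only [Complex.ofReal_zero, zero_mul, add_zero] at j1 j2
  -- Written with `dslope`, the corrected integrand is continuous at ρ too, which is all that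
  -- Cauchy's theorem needs at an exceptional point.
  set Φ : ℂ → ℂ := fun z => dslope N ρ z + N ρ * (z - τ)⁻¹ with hΦ
  have hΦeq : ∀ z, z ≠ ρ → Φ z = N z * (z - ρ)⁻¹ - N ρ * ((z - ρ)⁻¹ - (z - τ)⁻¹) := by
    intro z hz
    simp only [hΦ]
    rw [dslope_of_ne _ hz, slope_def_module, smul_eq_mul]
    ring
  have hline1 : (fun x : ℝ => Φ x)
      = fun x : ℝ => N x * ((x : ℂ) - ρ)⁻¹ - N ρ * (((x : ℂ) - ρ)⁻¹ - ((x : ℂ) - τ)⁻¹) := by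
    ext x
    apply hΦeq
    intro h
    rw [← h] at h0
    simp at h0
  have hline2 : (fun x : ℝ => Φ (x + h * Complex.I))
      = fun x : ℝ => N (x + h * Complex.I) * ((x : ℂ) + h * Complex.I - ρ)⁻¹
        - N ρ * (((x : ℂ) + h * Complex.I - ρ)⁻¹ - ((x : ℂ) + h * Complex.I - τ)⁻¹) := by
    ext x
    apply hΦeq
    intro h'
    rw [← h'] at h1
    simp at h1
  have k1 : Integrable fun x : ℝ => Φ x := by
    rw [hline1]; exact i1.sub (j1.1.const_mul _)
  have k2 : Integrable fun x : ℝ => Φ (x + h * Complex.I) := by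
    rw [hline2]; exact i2.sub (j2.1.const_mul _)
  have hρS : {z : ℂ | 0 ≤ z.im ∧ z.im ≤ h} ∈ 𝓝 ρ := by
    have ho : IsOpen {z : ℂ | 0 < z.im ∧ z.im < h} :=
      (isOpen_lt continuous_const Complex.continuous_im).inter
        (isOpen_lt Complex.continuous_im continuous_const)
    exact mem_of_superset (ho.mem_nhds ⟨h0, h1⟩) fun z hz => ⟨hz.1.le, hz.2.le⟩
  have hcont : ContinuousOn Φ {z : ℂ | 0 ≤ z.im ∧ z.im ≤ h} := by
    apply ContinuousOn.add
    · rw [continuousOn_dslope hρS]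
      exact ⟨fun z hz => (hN z hz.1 hz.2).continuousAt.continuousWithinAt, hN ρ h0.le h1.le⟩
    · apply ContinuousOn.mul continuousOn_const
      apply ContinuousOn.inv₀ (by fun_prop)
      intro z hz h'
      have := congrArg Complex.im h'
      rw [Complex.sub_im, hτim, Complex.zero_im] at this
      linarith [hz.1]
  have hdiff : ∀ z ∈ {z : ℂ | 0 ≤ z.im ∧ z.im ≤ h} \ {ρ}, DifferentiableAt ℂ Φ z := by
    intro z hz
    apply DifferentiableAt.add
    · rw [differentiableAt_dslope_of_ne hz.2]
      exact hN z hz.1.1 hz.1.2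
    · apply DifferentiableAt.mul (differentiableAt_const _)
      apply DifferentiableAt.inv (by fun_prop)
      intro h'
      have := congrArg Complex.im h'
      rw [Complex.sub_im, hτim, Complex.zero_im] at this
      linarith [hz.1.1]
  have hh : 0 < h := h0.trans h1
  have hrect : ∀ᶠ R : ℝ in atTop, (∫ x : ℝ in (-R)..R, Φ x)
      - (∫ x : ℝ in (-R)..R, Φ (x + h * Complex.I))
      = Complex.I * (∫ y : ℝ in (0 : ℝ)..h, Φ ((-R : ℝ) + y * Complex.I))
        - Complex.I * (∫ y : ℝ in (0 : ℝ)..h, Φ (R + y * Complex.I)) := by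
    filter_upwards [eventually_gt_atTop 0] with R hR
    have := Complex.integral_boundary_rect_eq_zero_of_differentiable_on_off_countable Φ
      ((-R : ℝ) : ℂ) (R + h * Complex.I) {ρ} (countable_singleton ρ) ?_ ?_
    · simp only [Complex.ofReal_re, Complex.ofReal_im, Complex.add_re, Complex.mul_re, Complex.I_re,
        mul_zero, Complex.I_im, mul_one, sub_self, add_zero, Complex.add_im, Complex.mul_im,
        zero_add, Complex.ofReal_zero, zero_mul, smul_eq_mul] at this
      linear_combination this
    · apply hcont.mono
      intro z hz
      rw [Complex.mem_reProdIm] at hz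
      have := hz.2
      simp only [Complex.ofReal_im, Complex.add_im, Complex.mul_im, Complex.ofReal_re, Complex.I_im,
        mul_one, Complex.I_re, mul_zero, add_zero, zero_add] at this
      rw [uIcc_of_le hh.le] at this
      exact this
    · intro z hz
      apply hdiff
      refine ⟨?_, hz.2⟩
      have hz := hz.1
      rw [Complex.mem_reProdIm] at hz
      have := hz.2
      simp only [Complex.ofReal_im, Complex.add_im, Complex.mul_im, Complex.ofReal_re, Complex.I_im,
        mul_one, Complex.I_re, mul_zero, add_zero, zero_add] at this
      rw [min_eq_left hh.le, max_eq_right hh.le] at this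
      exact ⟨this.1.le, this.2.le⟩
  have hinv : Tendsto (fun R : ℝ => (R - |ρ.re|)⁻¹) atTop (𝓝 0) :=
    tendsto_inv_atTop_zero.comp (tendsto_atTop_add_const_right _ _ tendsto_id)
  have hG : Tendsto (fun R : ℝ => (g R + ‖N ρ‖ * ((R - |ρ.re|)⁻¹ + (R - |ρ.re|)⁻¹)) * |h - 0|)
      atTop (𝓝 0) := by
    have := ((hg.add ((hinv.add hinv).const_mul ‖N ρ‖)).mul_const |h - 0|)
    simpa using this
  have hside : ∀ᶠ R in atTop, ∀ z : ℂ, 0 ≤ z.im → z.im ≤ h → |z.re| = R →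
      ‖Φ z‖ ≤ g R + ‖N ρ‖ * ((R - |ρ.re|)⁻¹ + (R - |ρ.re|)⁻¹) := by
    filter_upwards [hgN, eventually_gt_atTop |ρ.re|] with R hR hR2 z hz0 hz1 hzR
    rw [hΦeq z (by rintro rfl; linarith)]
    refine (norm_sub_le _ _).trans (add_le_add (hR z hz0 hz1 hzR) ?_)
    rw [norm_mul]
    refine mul_le_mul_of_nonneg_left ((norm_sub_le _ _).trans (add_le_add ?_ ?_)) (norm_nonneg _)
    · exact norm_inv_sub_le hR2 hzR
    · rw [← hτre]; exact norm_inv_sub_le (by rw [hτre]; exact hR2) hzR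
  have hv : ∀ s : ℝ, |s| = 1 →
      Tendsto (fun R : ℝ => ∫ y : ℝ in (0 : ℝ)..h, Φ ((s * R : ℝ) + y * Complex.I)) atTop (𝓝 0) := by
    intro s hs
    refine squeeze_zero_norm' ?_ hG
    filter_upwards [hside, eventually_gt_atTop 0] with R hR hR0
    apply intervalIntegral.norm_integral_le_of_norm_le_const
    intro y hy
    rw [uIoc_of_le hh.le] at hy
    apply hR
    · simpa using hy.1.le
    · simpa using hy.2
    · simp [abs_mul, hs, abs_of_pos hR0]
  have hvm := hv (-1) (by simp)
  have hvp := hv 1 (by simp)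
  simp only [neg_mul, one_mul] at hvm hvp
  have hlim1 := intervalIntegral_tendsto_integral k1 tendsto_neg_atTop_atBot tendsto_id
  have hlim2 := intervalIntegral_tendsto_integral k2 tendsto_neg_atTop_atBot tendsto_id
  have hlim := (hlim1.sub hlim2).congr' hrect
  have hlim' := (hvm.const_mul Complex.I).sub (hvp.const_mul Complex.I)
  have hfin := tendsto_nhds_unique hlim hlim'
  rw [hline1, hline2, integral_sub i1 (j1.1.const_mul _), integral_sub i2 (j2.1.const_mul _),
    integral_const_mul, integral_const_mul, j1.2, j2.2] at hfin
  push_cast at hfin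
  linear_combination hfin

end QPMelnikov

/-! ### Fourier transform of β: decay and integration by parts -/

namespace QPMelnikov
open Filter Topology Set

/-- The Fourier transform of `β`. -/
noncomputable def betaHat (α ν : ℝ) : ℂ :=
  ∫ v : ℝ, (beta α v : ℂ) * Complex.exp (Complex.I * ν * v)

lemma one_add_sq_le_four_mul_cosh (x : ℝ) : 1 + x ^ 2 ≤ 4 * Real.cosh x := by
  have h := Real.quadratic_le_exp_of_nonneg (abs_nonneg x)
  rw [← Real.cosh_abs, Real.cosh_eq]
  have := Real.exp_pos (-|x|)
  have := sq_abs x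
  have := abs_nonneg x
  linarith

lemma integrable_inv_cosh : Integrable fun x : ℝ => (Real.cosh x)⁻¹ := by
  refine Integrable.mono' (integrable_inv_one_add_sq.const_mul 4) ?_ (ae_of_all _ fun x => ?_)
  · apply Continuous.aestronglyMeasurable
    fun_prop (disch := exact fun x => (Real.cosh_pos x).ne')
  · have := Real.cosh_pos x
    rw [Real.norm_eq_abs, abs_of_pos (by positivity), ← div_eq_mul_inv,
      le_div_iff₀ (by positivity), inv_mul_le_iff₀ this]
    linarith [one_add_sq_le_four_mul_cosh x]

/-- The difference of the two sides is α (sinh v - 1)². -/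
lemma denom_lower {α : ℝ} (h0 : 0 < α) (v : ℝ) :
    (1 - α) * Real.cosh v ^ 2 ≤ Real.cosh v ^ 2 - 2 * α * Real.sinh v := by
  have := Real.cosh_sq v
  nlinarith [mul_nonneg h0.le (sq_nonneg (Real.sinh v - 1))]

lemma denom_pos {α : ℝ} (h0 : 0 < α) (h1 : α < 1) (v : ℝ) :
    0 < Real.cosh v ^ 2 - 2 * α * Real.sinh v :=
  lt_of_lt_of_le (mul_pos (by linarith) (pow_pos (Real.cosh_pos v) 2)) (denom_lower h0 v)

lemma continuous_beta {α : ℝ} (h0 : 0 < α) (h1 : α < 1) : Continuous (beta α) := by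
  unfold beta
  have := Real.continuous_cosh
  have := Real.continuous_sinh
  fun_prop (disch := exact fun v => (pow_pos (denom_pos h0 h1 v) 2).ne')

lemma abs_sinh_le_cosh (v : ℝ) : |Real.sinh v| ≤ Real.cosh v := by
  rw [abs_le]
  constructor <;> nlinarith [Real.cosh_sq v, Real.cosh_pos v]

lemma abs_beta_le {α : ℝ} (h0 : 0 < α) (h1 : α < 1) (v : ℝ) :
    |beta α v| ≤ (1 - α)⁻¹ ^ 2 * (Real.cosh v)⁻¹ := by
  have hc := Real.cosh_pos v
  have hc1 := Real.one_le_cosh v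
  have hd := denom_pos h0 h1 v
  unfold beta
  rw [abs_div, abs_mul, abs_of_pos hc, abs_of_pos (pow_pos hd 2)]
  have h2 : 0 < 1 - α := by linarith
  calc _ ≤ Real.cosh v * Real.cosh v / ((1 - α) * Real.cosh v ^ 2) ^ 2 := by
        gcongr
        · exact abs_sinh_le_cosh v
        · exact denom_lower h0 v
    _ = (1 - α)⁻¹ ^ 2 * ((Real.cosh v)⁻¹ * (Real.cosh v)⁻¹) := by field_simp
    _ ≤ (1 - α)⁻¹ ^ 2 * ((Real.cosh v)⁻¹ * 1) := by
        gcongr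
        exact inv_le_one_of_one_le₀ hc1
    _ = _ := by rw [mul_one]

lemma integrable_beta {α : ℝ} (h0 : 0 < α) (h1 : α < 1) : Integrable (beta α) :=
  Integrable.mono' (integrable_inv_cosh.const_mul _) (continuous_beta h0 h1).aestronglyMeasurable
    (ae_of_all _ fun v => abs_beta_le h0 h1 v)

lemma norm_exp_I_mul (ν v : ℝ) : ‖Complex.exp (Complex.I * ν * v)‖ = 1 := by
  rw [show Complex.I * ν * v = ((ν * v : ℝ) : ℂ) * Complex.I by push_cast; ring,
    Complex.norm_exp_ofReal_mul_I]

/-- The numerator left after integrating by parts to lower the order of the poles. -/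
noncomputable def shiftNum (α ν : ℝ) (z : ℂ) : ℂ :=
  α * Complex.cosh z - Complex.I * ν * (α * Complex.sinh z - 1)

lemma norm_sinh_le (z : ℂ) : ‖Complex.sinh z‖ ≤ Real.cosh z.re := by
  rw [Complex.sinh, norm_div, Complex.norm_ofNat, Real.cosh_eq]
  gcongr
  refine (norm_sub_le _ _).trans ?_
  rw [Complex.norm_exp, Complex.norm_exp, Complex.neg_re]

lemma norm_cosh_le (z : ℂ) : ‖Complex.cosh z‖ ≤ Real.cosh z.re := by
  rw [Complex.cosh, norm_div, Complex.norm_ofNat, Real.cosh_eq]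
  gcongr
  refine (norm_add_le _ _).trans ?_
  rw [Complex.norm_exp, Complex.norm_exp, Complex.neg_re]

lemma sinh_abs_re_le (z : ℂ) : Real.sinh |z.re| ≤ ‖Complex.sinh z‖ := by
  rw [Complex.sinh, norm_div, Complex.norm_ofNat, Real.sinh_eq]
  gcongr
  have h := abs_norm_sub_norm_le (Complex.exp z) (Complex.exp (-z))
  rw [Complex.norm_exp, Complex.norm_exp, Complex.neg_re] at h
  refine le_trans ?_ h
  rcases abs_cases z.re with ⟨e, -⟩ | ⟨e, -⟩ <;> rw [e]
  · exact le_abs_self _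
  · rw [neg_neg, ← neg_sub]
    exact neg_le_abs _

lemma norm_shiftNum_le {α ν : ℝ} (h0 : 0 < α) (h1 : α < 1) (hν : 0 ≤ ν) (z : ℂ) :
    ‖shiftNum α ν z‖ ≤ (1 + 2 * ν) * Real.cosh z.re := by
  have hα : ‖(α : ℂ)‖ = α := by rw [Complex.norm_real, Real.norm_eq_abs, abs_of_pos h0]
  have hν' : ‖(ν : ℂ)‖ = ν := by rw [Complex.norm_real, Real.norm_eq_abs, abs_of_nonneg hν]
  have hc1 := Real.one_le_cosh z.re
  unfold shiftNum
  calc _ ≤ ‖(α : ℂ) * Complex.cosh z‖ + ‖Complex.I * ν * (α * Complex.sinh z - 1)‖ :=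
        norm_sub_le _ _
    _ ≤ 1 * Real.cosh z.re + 1 * ν * (1 * Real.cosh z.re + 1) := by
        rw [norm_mul, norm_mul, norm_mul, hα, hν', Complex.norm_I]
        gcongr
        · exact norm_cosh_le z
        · refine (norm_sub_le _ _).trans ?_
          rw [norm_mul, hα, norm_one]
          gcongr
          exact norm_sinh_le z
    _ ≤ _ := by nlinarith

/-- With q the denominator, the derivative of (α sinh v - 1)/q is 2(1 - α²)β - α cosh v / q.
Multiplying by e^{iνv} and integrating the total derivative, which contributes zero, lowers the pole
order from two to one. -/
lemma two_mul_one_sub_sq_mul_betaHat {α : ℝ} (h0 : 0 < α) (h1 : α < 1) {ν : ℝ} (hν : 0 ≤ ν) :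
    Integrable (fun v : ℝ => shiftNum α ν v /
      ((Real.cosh v ^ 2 - 2 * α * Real.sinh v : ℝ) : ℂ) * Complex.exp (Complex.I * ν * v)) ∧
    2 * ((1 - α ^ 2 : ℝ) : ℂ) * betaHat α ν = ∫ v : ℝ, shiftNum α ν v /
      ((Real.cosh v ^ 2 - 2 * α * Real.sinh v : ℝ) : ℂ) * Complex.exp (Complex.I * ν * v) := by
  have hq : ∀ v, 0 < Real.cosh v ^ 2 - 2 * α * Real.sinh v := denom_pos h0 h1
  set q : ℝ → ℝ := fun v => Real.cosh v ^ 2 - 2 * α * Real.sinh v with hqdef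
  have hqc : Continuous q := by
    have := Real.continuous_cosh
    have := Real.continuous_sinh
    fun_prop
  have hqC : ∀ v, (q v : ℂ) ≠ 0 := fun v => by exact_mod_cast (hq v).ne'
  have hbound : ∀ v, (q v)⁻¹ * Real.cosh v ≤ (1 - α)⁻¹ * (Real.cosh v)⁻¹ := by
    intro v
    have hc := Real.cosh_pos v
    have h2 : 0 < 1 - α := by linarith
    calc (q v)⁻¹ * Real.cosh v ≤ ((1 - α) * Real.cosh v ^ 2)⁻¹ * Real.cosh v := by
          gcongr
          exact denom_lower h0 v
      _ = _ := by field_simp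
  set ψ : ℝ → ℂ := fun v => shiftNum α ν v / (q v : ℂ) * Complex.exp (Complex.I * ν * v) with hψ
  have hsc : Continuous fun v : ℝ => shiftNum α ν v := by
    unfold shiftNum; fun_prop
  have hψi : Integrable ψ := by
    refine Integrable.mono' (integrable_inv_cosh.const_mul ((1 + 2 * ν) * (1 - α)⁻¹)) ?_
      (ae_of_all _ fun v => ?_)
    · apply Continuous.aestronglyMeasurable
      simp only [hψ]
      fun_prop (disch := exact hqC)
    · simp only [hψ]
      rw [norm_mul, norm_exp_I_mul, mul_one, norm_div, Complex.norm_real, Real.norm_eq_abs,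
        abs_of_pos (hq v), div_eq_inv_mul]
      have h3 := norm_shiftNum_le h0 h1 hν v
      rw [Complex.ofReal_re] at h3
      have := inv_pos.2 (hq v)
      calc (q v)⁻¹ * ‖shiftNum α ν v‖ ≤ (q v)⁻¹ * ((1 + 2 * ν) * Real.cosh v) := by gcongr
        _ = (1 + 2 * ν) * ((q v)⁻¹ * Real.cosh v) := by ring
        _ ≤ (1 + 2 * ν) * ((1 - α)⁻¹ * (Real.cosh v)⁻¹) :=
            mul_le_mul_of_nonneg_left (hbound v) (by linarith)
        _ = _ := by ring
  refine ⟨hψi, ?_⟩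
  have hβi : Integrable fun v : ℝ => (beta α v : ℂ) * Complex.exp (Complex.I * ν * v) := by
    refine (integrable_beta h0 h1).ofReal.mul_bdd (c := 1) ?_ (ae_of_all _ fun v => ?_)
    · exact Continuous.aestronglyMeasurable (by fun_prop)
    · rw [norm_exp_I_mul]
  set G : ℝ → ℂ := fun v =>
    ((α * Real.sinh v - 1 : ℝ) : ℂ) * (q v : ℂ)⁻¹ * Complex.exp (Complex.I * ν * v) with hG
  have hGi : Integrable G := by
    refine Integrable.mono' (integrable_inv_cosh.const_mul (2 * (1 - α)⁻¹)) ?_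
      (ae_of_all _ fun v => ?_)
    · apply Continuous.aestronglyMeasurable
      have := Real.continuous_sinh
      simp only [hG]
      fun_prop (disch := exact hqC)
    · simp only [hG]
      rw [norm_mul, norm_exp_I_mul, mul_one, norm_mul, norm_inv, Complex.norm_real,
        Complex.norm_real, Real.norm_eq_abs, Real.norm_eq_abs, abs_of_pos (hq v), mul_comm]
      have := inv_pos.2 (hq v)
      have h3 : |α * Real.sinh v - 1| ≤ 2 * Real.cosh v := by
        have := abs_le.1 (abs_sinh_le_cosh v)
        have := Real.one_le_cosh v
        rw [abs_le]
        constructor <;> nlinarith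
      calc (q v)⁻¹ * |α * Real.sinh v - 1| ≤ (q v)⁻¹ * (2 * Real.cosh v) := by gcongr
        _ = 2 * ((q v)⁻¹ * Real.cosh v) := by ring
        _ ≤ 2 * ((1 - α)⁻¹ * (Real.cosh v)⁻¹) :=
            mul_le_mul_of_nonneg_left (hbound v) (by linarith)
        _ = _ := by ring
  have hderiv : ∀ v, HasDerivAt G
      (2 * ((1 - α ^ 2 : ℝ) : ℂ) * ((beta α v : ℂ) * Complex.exp (Complex.I * ν * v)) - ψ v) v := by
    intro v
    have d1 : HasDerivAt q (2 * Real.cosh v * Real.sinh v - 2 * α * Real.cosh v) v := by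
      refine (((Real.hasDerivAt_cosh v).pow 2).sub
        ((Real.hasDerivAt_sinh v).const_mul (2 * α))).congr_deriv ?_
      simp
    have d2 : HasDerivAt (fun v => (α * Real.sinh v - 1) * (q v)⁻¹)
        (α * Real.cosh v * (q v)⁻¹ + (α * Real.sinh v - 1) *
          (-(2 * Real.cosh v * Real.sinh v - 2 * α * Real.cosh v) / q v ^ 2)) v :=
      (((Real.hasDerivAt_sinh v).const_mul α).sub_const 1).mul (d1.inv (hq v).ne')
    have d3 : HasDerivAt (fun v : ℝ => Complex.exp (Complex.I * ν * v))
        (Complex.exp (Complex.I * ν * v) * (Complex.I * ν * 1)) v :=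
      ((Complex.ofRealCLM.hasDerivAt (x := v)).const_mul (Complex.I * ν)).cexp
    have d4 := d2.ofReal_comp.mul d3
    have e0 : G = (fun y => ((((α * Real.sinh y - 1) * (q y)⁻¹ : ℝ)) : ℂ)) *
        (fun v : ℝ => Complex.exp (Complex.I * ν * v)) := by
      ext y; simp only [hG, Pi.mul_apply]; push_cast; ring
    rw [e0]
    refine d4.congr_deriv ?_
    have hb : beta α v = Real.sinh v * Real.cosh v / q v ^ 2 := rfl
    simp only [hψ, shiftNum]
    rw [hb]
    have hqv := hqC v
    have hqe : (q v : ℂ) = Complex.cosh v ^ 2 - 2 * α * Complex.sinh v := by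
      simp only [hqdef]; push_cast; ring
    have hcs := Complex.cosh_sq (v : ℂ)
    push_cast
    field_simp
    rw [hqe, hcs]
    ring
  have hβ2 := hβi.const_mul (2 * ((1 - α ^ 2 : ℝ) : ℂ))
  have := integral_eq_zero_of_hasDerivAt_of_integrable hderiv (hβ2.sub hψi) hGi
  rw [integral_sub hβ2 hψi, integral_const_mul] at this
  exact sub_eq_zero.1 this

end QPMelnikov

/-! ### Residue at ρ₋ and two-sided bounds for β̂ -/

namespace QPMelnikov
open Filter Topology Set

lemma sinh_re_im (z : ℂ) :
    Complex.sinh z = ⟨Real.sinh z.re * Real.cos z.im, Real.cosh z.re * Real.sin z.im⟩ := by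
  conv_lhs => rw [← Complex.re_add_im z, Complex.sinh_add, Complex.sinh_mul_I, Complex.cosh_mul_I,
    ← Complex.ofReal_sinh, ← Complex.ofReal_cosh, ← Complex.ofReal_sin, ← Complex.ofReal_cos]
  apply Complex.ext <;> simp [Complex.sinh_ofReal_re, Complex.cosh_ofReal_re, Complex.sin_ofReal_re,
    Complex.cos_ofReal_re]

lemma cosh_re_im (z : ℂ) :
    Complex.cosh z = ⟨Real.cosh z.re * Real.cos z.im, Real.sinh z.re * Real.sin z.im⟩ := by
  conv_lhs => rw [← Complex.re_add_im z, Complex.cosh_add, Complex.sinh_mul_I, Complex.cosh_mul_I,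
    ← Complex.ofReal_sinh, ← Complex.ofReal_cosh, ← Complex.ofReal_sin, ← Complex.ofReal_cos]
  apply Complex.ext <;> simp [Complex.sinh_ofReal_re, Complex.cosh_ofReal_re, Complex.sin_ofReal_re,
    Complex.cos_ofReal_re]

section Pole

variable {α : ℝ}

lemma sqrt_one_sub_sq_pos (h0 : 0 < α) (h1 : α < 1) : 0 < √(1 - α ^ 2) :=
  Real.sqrt_pos.2 (by nlinarith)

lemma sq_sqrt_one_sub_sq (h0 : 0 < α) (h1 : α < 1) : √(1 - α ^ 2) ^ 2 = 1 - α ^ 2 :=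
  Real.sq_sqrt (by nlinarith)

lemma rhoMinus_equations (α : ℝ) :
    Real.sinh (rhoMinus α).re * Real.cos (rhoMinus α).im = α ∧
    Real.cosh (rhoMinus α).re * Real.sin (rhoMinus α).im = √(1 - α ^ 2) := by
  have h := sinh_rhoMinus α
  rw [sinh_re_im] at h
  exact ⟨congrArg Complex.re h, congrArg Complex.im h⟩

/-- Uniqueness extends to the closed strip: sinh is real on Im z = 0 and purely imaginary on Im z =
π/2, whereas both parts of the target are positive. -/
lemma eq_rhoMinus_of_sinh_eq (h0 : 0 < α) (h1 : α < 1) {z : ℂ} (hz0 : 0 ≤ z.im)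
    (hz1 : z.im ≤ π / 2) (hz : Complex.sinh z = rhoSinh α) : z = rhoMinus α := by
  have hη := sqrt_one_sub_sq_pos h0 h1
  have h := hz
  rw [sinh_re_im] at h
  have hre := congrArg Complex.re h
  have him := congrArg Complex.im h
  simp only [rhoSinh] at hre him
  apply rhoMinus_unique h0 h1 hz
  constructor
  · apply lt_of_le_of_ne hz0
    intro h
    rw [← h, Real.sin_zero, mul_zero] at him
    linarith
  · apply lt_of_le_of_ne hz1
    intro h
    rw [h, Real.cos_pi_div_two, mul_zero] at hre
    linarith

/-- Im sinh z ≥ 0 on the strip, so the conjugate root of the denominator contributes no pole there.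
-/
lemma sinh_ne_conj (h0 : 0 < α) (h1 : α < 1) {z : ℂ} (hz0 : 0 ≤ z.im) (hz1 : z.im ≤ π / 2) :
    Complex.sinh z - (starRingEnd ℂ) (rhoSinh α) ≠ 0 := by
  intro h
  have hη := sqrt_one_sub_sq_pos h0 h1
  have him := congrArg Complex.im (sub_eq_zero.1 h)
  rw [sinh_re_im, Complex.conj_im] at him
  simp only [rhoSinh] at him
  have : 0 ≤ Real.cosh z.re * Real.sin z.im :=
    mul_nonneg (Real.cosh_pos _).le (Real.sin_nonneg_of_nonneg_of_le_pi hz0 (by linarith [Real.pi_pos]))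
  linarith

lemma cosh_rhoMinus_sq (α : ℝ) : Complex.cosh (rhoMinus α) ^ 2 = 1 + rhoSinh α ^ 2 := by
  rw [Complex.cosh_sq, sinh_rhoMinus, add_comm]

lemma rhoSinh_eq (α : ℝ) : rhoSinh α = α + √(1 - α ^ 2) * Complex.I := by
  apply Complex.ext <;> simp [rhoSinh]

lemma cosh_rhoMinus_re_pos (h0 : 0 < α) (h1 : α < 1) : 0 < (Complex.cosh (rhoMinus α)).re := by
  have := rhoMinus_im_mem h0 h1
  rw [cosh_re_im]
  exact mul_pos (Real.cosh_pos _) (Real.cos_pos_of_mem_Ioo ⟨by linarith [this.1, Real.pi_pos], this.2⟩)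

lemma cosh_rhoMinus_ne_zero (h0 : 0 < α) (h1 : α < 1) : Complex.cosh (rhoMinus α) ≠ 0 := by
  intro h
  have := cosh_rhoMinus_re_pos h0 h1
  rw [h] at this
  simp at this

/-- The regular factor of the integrand at the pole `ρ₋`. -/
noncomputable def regFactor (α ν : ℝ) (z : ℂ) : ℂ :=
  shiftNum α ν z * Complex.exp (Complex.I * ν * z) /
    ((Complex.sinh z - (starRingEnd ℂ) (rhoSinh α)) * dslope Complex.sinh (rhoMinus α) z)

/-- A zero away from ρ₋ would be a second preimage of sinh ρ₋; a zero at ρ₋ would force cosh ρ₋ = 0.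
-/
lemma dslope_sinh_ne_zero (h0 : 0 < α) (h1 : α < 1) {z : ℂ} (hz0 : 0 ≤ z.im)
    (hz1 : z.im ≤ π / 2) : dslope Complex.sinh (rhoMinus α) z ≠ 0 := by
  intro h
  have h2 := sub_smul_dslope Complex.sinh (rhoMinus α) z
  rw [h, smul_zero, sinh_rhoMinus, eq_comm, sub_eq_zero] at h2
  have h3 := eq_rhoMinus_of_sinh_eq h0 h1 hz0 hz1 h2
  rw [h3, dslope_same, Complex.deriv_sinh] at h
  exact cosh_rhoMinus_ne_zero h0 h1 h

lemma differentiableAt_regFactor (h0 : 0 < α) (h1 : α < 1) (ν : ℝ) {z : ℂ} (hz0 : 0 ≤ z.im)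
    (hz1 : z.im ≤ π / 2) : DifferentiableAt ℂ (regFactor α ν) z := by
  have hd : Differentiable ℂ (dslope Complex.sinh (rhoMinus α)) := by
    rw [← differentiableOn_univ, Complex.differentiableOn_dslope univ_mem, differentiableOn_univ]
    exact Complex.differentiable_sinh
  unfold regFactor
  refine DifferentiableAt.div ?_ (((Complex.differentiable_sinh z).sub_const _).mul (hd z))
    (mul_ne_zero (sinh_ne_conj h0 h1 hz0 hz1) (dslope_sinh_ne_zero h0 h1 hz0 hz1))
  unfold shiftNum
  fun_prop

lemma regFactor_mul_inv (ν : ℝ) {z : ℂ} (hz : z ≠ rhoMinus α) :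
    regFactor α ν z * (z - rhoMinus α)⁻¹ = shiftNum α ν z /
      ((Complex.sinh z - (starRingEnd ℂ) (rhoSinh α)) * (Complex.sinh z - rhoSinh α)) *
        Complex.exp (Complex.I * ν * z) := by
  have h2 := sub_smul_dslope Complex.sinh (rhoMinus α) z
  rw [sinh_rhoMinus, smul_eq_mul] at h2
  have hz' := sub_ne_zero.2 hz
  rw [← h2, regFactor]
  field_simp

lemma denom_factor (h0 : 0 < α) (h1 : α < 1) (v : ℝ) :
    (Complex.sinh v - (starRingEnd ℂ) (rhoSinh α)) * (Complex.sinh v - rhoSinh α)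
      = ((Real.cosh v ^ 2 - 2 * α * Real.sinh v : ℝ) : ℂ) := by
  have h : ((√(1 - α ^ 2) : ℝ) : ℂ) ^ 2 = 1 - α ^ 2 := by
    exact_mod_cast sq_sqrt_one_sub_sq h0 h1
  have hcs := Complex.cosh_sq (v : ℂ)
  rw [rhoSinh_eq, map_add, map_mul, Complex.conj_ofReal, Complex.conj_ofReal, Complex.conj_I]
  push_cast
  rw [hcs]
  linear_combination h - ((√(1 - α ^ 2) : ℝ) : ℂ) ^ 2 * Complex.I_sq

/-- For ζ = sinh ρ₋ = α + iη, the relation |ζ| = 1 gives αζ - 1 = iηζ, which puts the numerator in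
this form. The other factors are ζ - ζ̄ = 2iη and the derivative cosh ρ₋. -/
lemma regFactor_rhoMinus (h0 : 0 < α) (h1 : α < 1) (ν : ℝ) :
    2 * π * Complex.I * regFactor α ν (rhoMinus α) =
      π / √(1 - α ^ 2) * Complex.exp (Complex.I * ν * rhoMinus α) *
        ((α * Complex.cosh (rhoMinus α) + ν * √(1 - α ^ 2) * rhoSinh α) /
          Complex.cosh (rhoMinus α)) := by
  have h : ((√(1 - α ^ 2) : ℝ) : ℂ) ^ 2 = 1 - α ^ 2 := by
    exact_mod_cast sq_sqrt_one_sub_sq h0 h1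
  have hη : ((√(1 - α ^ 2) : ℝ) : ℂ) ≠ 0 := by
    exact_mod_cast (sqrt_one_sub_sq_pos h0 h1).ne'
  have hI := Complex.I_ne_zero
  have e1 : rhoSinh α - (starRingEnd ℂ) (rhoSinh α) = 2 * Complex.I * √(1 - α ^ 2) := by
    rw [rhoSinh_eq, map_add, map_mul, Complex.conj_ofReal, Complex.conj_ofReal, Complex.conj_I]
    ring
  have e2 : shiftNum α ν (rhoMinus α)
      = α * Complex.cosh (rhoMinus α) + ν * √(1 - α ^ 2) * rhoSinh α := by
    rw [shiftNum, sinh_rhoMinus, rhoSinh_eq]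
    linear_combination (-Complex.I * ν) * h - ν * (√(1 - α ^ 2) : ℂ) * α * Complex.I_sq
  rw [regFactor, dslope_same, Complex.deriv_sinh, sinh_rhoMinus, e1, e2]
  have := cosh_rhoMinus_ne_zero h0 h1
  field_simp

lemma tendsto_cosh_atTop : Tendsto Real.cosh atTop atTop := by
  refine tendsto_atTop_mono (f := fun x : ℝ => x / 4) (fun x => ?_)
    (tendsto_id.atTop_div_const (by norm_num))
  nlinarith [one_add_sq_le_four_mul_cosh x, sq_nonneg (x - 1)]

lemma norm_rhoSinh (h0 : 0 < α) (h1 : α < 1) : ‖rhoSinh α‖ = 1 := by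
  have h := sq_sqrt_one_sub_sq h0 h1
  rw [← sq_eq_sq₀ (norm_nonneg _) zero_le_one, Complex.sq_norm, Complex.normSq_apply]
  simp only [rhoSinh]
  linarith

/-- Evaluation of the Fourier transform of `β` by residues, with an explicit remainder. -/
lemma betaHat_residue (h0 : 0 < α) (h1 : α < 1) (hη : √(1 - α ^ 2) ≤ 1 / 2) {ν : ℝ} (hν : 0 ≤ ν) :
    ‖2 * ((1 - α ^ 2 : ℝ) : ℂ) * betaHat α ν -
      π / √(1 - α ^ 2) * Complex.exp (Complex.I * ν * rhoMinus α) *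
        ((α * Complex.cosh (rhoMinus α) + ν * √(1 - α ^ 2) * rhoSinh α) /
          Complex.cosh (rhoMinus α))‖
      ≤ 4 * (1 + 2 * ν) * Real.exp (-(ν * (π / 2))) * ∫ x : ℝ, (Real.cosh x)⁻¹ := by
  obtain ⟨hi, he⟩ := two_mul_one_sub_sq_mul_betaHat h0 h1 hν
  obtain ⟨hb0, hb1⟩ := rhoMinus_im_mem h0 h1
  have hpi := Real.pi_pos
  set ρ := rhoMinus α with hρ
  have hline : (fun x : ℝ => regFactor α ν x * ((x : ℂ) - ρ)⁻¹)
      = fun v : ℝ => shiftNum α ν v / ((Real.cosh v ^ 2 - 2 * α * Real.sinh v : ℝ) : ℂ) *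
        Complex.exp (Complex.I * ν * v) := by
    ext x
    rw [regFactor_mul_inv, denom_factor h0 h1]
    intro h
    have := congrArg Complex.im h
    rw [Complex.ofReal_im] at this
    linarith
  have hexp : ∀ z : ℂ, ‖Complex.exp (Complex.I * ν * z)‖ = Real.exp (-(ν * z.im)) := by
    intro z
    rw [Complex.norm_exp]
    simp
  have hup : ∀ x : ℝ, ‖regFactor α ν (x + (π / 2 : ℝ) * Complex.I) *
      ((x : ℂ) + (π / 2 : ℝ) * Complex.I - ρ)⁻¹‖
        ≤ 4 * (1 + 2 * ν) * Real.exp (-(ν * (π / 2))) * (Real.cosh x)⁻¹ := by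
    intro x
    have hc := Real.cosh_pos x
    have hc1 := Real.one_le_cosh x
    set z : ℂ := (x : ℂ) + (π / 2 : ℝ) * Complex.I with hz
    have hzre : z.re = x := by simp [hz]
    have hzim : z.im = π / 2 := by simp [hz]
    have hs : (Complex.sinh z).im = Real.cosh x := by
      rw [sinh_re_im, hzre, hzim]; simp
    have hηp := sqrt_one_sub_sq_pos h0 h1
    -- On this line sinh z = i cosh x with cosh x ≥ 1, so η ≤ 1/2 keeps both factors away from zero.
    -- The remainder therefore carries no negative power of η.
    have hA : Real.cosh x / 2 ≤ ‖Complex.sinh z - (starRingEnd ℂ) (rhoSinh α)‖ := by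
      refine le_trans ?_ ((le_abs_self _).trans (Complex.abs_im_le_norm _))
      rw [Complex.sub_im, hs, Complex.conj_im]
      simp only [rhoSinh]
      linarith
    have hB : Real.cosh x / 2 ≤ ‖Complex.sinh z - rhoSinh α‖ := by
      refine le_trans ?_ ((le_abs_self _).trans (Complex.abs_im_le_norm _))
      rw [Complex.sub_im, hs]
      simp only [rhoSinh]
      linarith
    have hzne : z ≠ ρ := by
      intro h
      rw [h] at hzim
      linarith
    have hn := norm_shiftNum_le h0 h1 hν z
    rw [hzre] at hn
    rw [regFactor_mul_inv _ hzne, norm_mul, norm_div, norm_mul, hexp, hzim]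
    calc _ ≤ (1 + 2 * ν) * Real.cosh x / (Real.cosh x / 2 * (Real.cosh x / 2)) *
          Real.exp (-(ν * (π / 2))) := by gcongr
      _ = _ := by field_simp; norm_num
  have hgint : Integrable fun x : ℝ =>
      4 * (1 + 2 * ν) * Real.exp (-(ν * (π / 2))) * (Real.cosh x)⁻¹ :=
    integrable_inv_cosh.const_mul _
  have hside : ∀ᶠ R in atTop, ∀ z : ℂ, 0 ≤ z.im → z.im ≤ π / 2 → |z.re| = R →
      ‖regFactor α ν z * (z - ρ)⁻¹‖ ≤ 16 * (1 + 2 * ν) * (Real.cosh R)⁻¹ := by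
    filter_upwards [eventually_ge_atTop 2, eventually_gt_atTop |ρ.re|] with R hR hR2 z hz0 hz1 hzR
    have hzne : z ≠ ρ := by rintro rfl; linarith
    have hn := norm_shiftNum_le h0 h1 hν z
    have hcz : Real.cosh z.re = Real.cosh R := by rw [← hzR, Real.cosh_abs]
    have hs := sinh_abs_re_le z
    rw [hzR] at hs
    have hs2 : R ≤ Real.sinh R := Real.self_le_sinh_iff.2 (by linarith)
    have hc := Real.cosh_pos R
    have hcs : Real.cosh R ≤ 2 * Real.sinh R := by
      nlinarith [Real.cosh_sq R]
    have hx := norm_rhoSinh h0 h1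
    -- Here |sinh z| ≥ sinh R ≥ 2 and both roots have modulus 1, so at least half of sinh R
    -- survives.
    have hA : Real.cosh R / 4 ≤ ‖Complex.sinh z - (starRingEnd ℂ) (rhoSinh α)‖ := by
      have := norm_sub_norm_le (Complex.sinh z) ((starRingEnd ℂ) (rhoSinh α))
      rw [RCLike.norm_conj, hx] at this
      linarith
    have hB : Real.cosh R / 4 ≤ ‖Complex.sinh z - rhoSinh α‖ := by
      have := norm_sub_norm_le (Complex.sinh z) (rhoSinh α)
      rw [hx] at this
      linarith
    rw [regFactor_mul_inv _ hzne, norm_mul, norm_div, norm_mul, hexp]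
    rw [hcz] at hn
    have he1 : Real.exp (-(ν * z.im)) ≤ 1 := by
      rw [Real.exp_le_one_iff]
      nlinarith
    calc _ ≤ (1 + 2 * ν) * Real.cosh R / (Real.cosh R / 4 * (Real.cosh R / 4)) * 1 := by gcongr
      _ = _ := by field_simp; norm_num
  have hg0 : Tendsto (fun R => 16 * (1 + 2 * ν) * (Real.cosh R)⁻¹) atTop (𝓝 0) := by
    simpa using (tendsto_inv_atTop_zero.comp tendsto_cosh_atTop).const_mul (16 * (1 + 2 * ν))
  have hi2 : Integrable fun x : ℝ => regFactor α ν (x + (π / 2 : ℝ) * Complex.I) *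
      ((x : ℂ) + (π / 2 : ℝ) * Complex.I - ρ)⁻¹ := by
    refine Integrable.mono' hgint ?_ (ae_of_all _ hup)
    apply Continuous.aestronglyMeasurable
    apply Continuous.mul
    · rw [continuous_iff_continuousAt]
      intro x
      have hd : ContinuousAt (regFactor α ν) (x + (π / 2 : ℝ) * Complex.I) :=
        (differentiableAt_regFactor h0 h1 ν (by simp; positivity) (by simp)).continuousAt
      exact ContinuousAt.comp (f := fun x : ℝ => (x : ℂ) + (π / 2 : ℝ) * Complex.I) hd
        (by fun_prop)
    · refine Continuous.inv₀ (by fun_prop) fun x h => ?_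
      have := congrArg Complex.im h
      simp at this
      linarith
  have hmain := integral_sub_integral_shift hb0 hb1
    (fun z hz0 hz1 => differentiableAt_regFactor h0 h1 ν hz0 hz1) hg0 hside
    (by rw [hline]; exact hi) hi2
  rw [hline, ← he, regFactor_rhoMinus h0 h1] at hmain
  rw [hmain, add_sub_cancel_left]
  refine (norm_integral_le_of_norm_le hgint (ae_of_all _ hup)).trans_eq ?_
  rw [integral_const_mul]

lemma cosh_rhoMinus_bounds (h0 : 0 < α) (h1 : α < 1) (hη : √(1 - α ^ 2) ≤ 1 / 2) :
    1 ≤ ‖Complex.cosh (rhoMinus α)‖ ∧ ‖Complex.cosh (rhoMinus α)‖ ^ 2 ≤ 2 := by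
  have hη2 := sq_sqrt_one_sub_sq h0 h1
  have hη0 := sqrt_one_sub_sq_pos h0 h1
  have h : ‖Complex.cosh (rhoMinus α)‖ ^ 2 = ‖1 + rhoSinh α ^ 2‖ := by
    rw [← norm_pow, cosh_rhoMinus_sq]
  constructor
  · rw [← abs_of_nonneg (norm_nonneg (Complex.cosh (rhoMinus α))), ← one_le_sq_iff_one_le_abs, h]
    refine le_trans ?_ (Complex.re_le_norm _)
    rw [sq, Complex.add_re, Complex.mul_re]
    simp only [rhoSinh, Complex.one_re]
    nlinarith
  · rw [h]
    refine (norm_add_le _ _).trans ?_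
    rw [norm_pow, norm_rhoSinh h0 h1, norm_one]
    norm_num

/-- This keeps α cosh ρ₋ in the right half-plane, so it cannot cancel against νη sinh ρ₋ in the
residue. -/
lemma cosh_rhoMinus_re_ge (h0 : 0 < α) (h1 : α < 1) (hη : √(1 - α ^ 2) ≤ 1 / 2) :
    1 / 2 ≤ (Complex.cosh (rhoMinus α)).re := by
  obtain ⟨-, e⟩ := rhoMinus_equations α
  obtain ⟨hb0, hb1⟩ := rhoMinus_im_mem h0 h1
  have hpi := Real.pi_pos
  have hc := Real.one_le_cosh (rhoMinus α).re
  have hs := Real.sin_pos_of_pos_of_lt_pi hb0 (by linarith)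
  have hcos := Real.cos_pos_of_mem_Ioo (x := (rhoMinus α).im) ⟨by linarith, hb1⟩
  have hsc := Real.sin_sq_add_cos_sq (rhoMinus α).im
  rw [cosh_re_im]
  simp only
  have h3 : Real.sin (rhoMinus α).im ≤ 1 / 2 := by nlinarith
  have h4 : 1 / 2 ≤ Real.cos (rhoMinus α).im := by nlinarith
  nlinarith

/-- `Im ρ₋` is comparable to `√(1 - α²)`. -/
lemma rhoMinus_im_bounds (h0 : 0 < α) (h1 : α < 1) (hη : √(1 - α ^ 2) ≤ 1 / 2) :
    √(1 - α ^ 2) ≤ 2 * (rhoMinus α).im ∧ (rhoMinus α).im ≤ 2 * √(1 - α ^ 2) := by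
  obtain ⟨-, e⟩ := rhoMinus_equations α
  obtain ⟨hb0, hb1⟩ := rhoMinus_im_mem h0 h1
  have hpi := Real.pi_pos
  have hc := Real.one_le_cosh (rhoMinus α).re
  have hs := Real.sin_pos_of_pos_of_lt_pi hb0 (by linarith)
  have hsc := Real.sin_sq_add_cos_sq (rhoMinus α).im
  constructor
  · have h2 := (cosh_rhoMinus_bounds h0 h1 hη).2
    rw [Complex.sq_norm, Complex.normSq_apply, cosh_re_im] at h2
    simp only at h2
    have hcs := Real.cosh_sq (rhoMinus α).re
    -- From |cosh ρ₋|² = cosh²(Re ρ₋) - sin²(Im ρ₋) ≤ 2.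
    have h3 : Real.cosh (rhoMinus α).re ≤ 2 := by nlinarith
    have := Real.sin_le hb0.le
    nlinarith
  · have h2 := Real.mul_le_sin hb0.le hb1.le
    rw [div_mul_eq_mul_div, div_le_iff₀ hpi] at h2
    have := Real.pi_lt_four
    nlinarith

/-- The common order of magnitude of the Fourier transform of `β` at frequency `ν`. -/
noncomputable def hatSize (α ν : ℝ) : ℝ :=
  (1 + ν * √(1 - α ^ 2)) * Real.exp (-(ν * (rhoMinus α).im)) / √(1 - α ^ 2) ^ 3

/-- The gap between the heights π/2 and b exceeds 1/2, and e^{-ν/2} absorbs the linear factor. -/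
lemma one_add_mul_exp_le {b ν : ℝ} (hν : 0 ≤ ν) (hb : b ≤ 1) :
    (1 + 2 * ν) * Real.exp (-(ν * (π / 2))) ≤ 4 * Real.exp (-(ν * b)) := by
  have hpi := Real.pi_gt_three
  calc (1 + 2 * ν) * Real.exp (-(ν * (π / 2)))
      ≤ (4 * Real.exp (ν / 2)) * Real.exp (-(ν * b) - ν / 2) := by
        gcongr
        · linarith [Real.add_one_le_exp (ν / 2)]
        · nlinarith
    _ = _ := by
        rw [mul_assoc, ← Real.exp_add]
        ring_nf

end Pole

/-- Two-sided bound for the Fourier transform of `β`, uniform as `α → 1`. -/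
theorem betaHat_bounds : ∃ η₀ > 0, ∃ D > 0, ∀ α : ℝ, 0 < α → α < 1 → √(1 - α ^ 2) ≤ η₀ →
    √(1 - α ^ 2) ≤ 1 / 2 ∧
    ∀ ν : ℝ, 0 ≤ ν → hatSize α ν / 8 ≤ ‖betaHat α ν‖ ∧ ‖betaHat α ν‖ ≤ D * hatSize α ν := by
  set K : ℝ := ∫ x : ℝ, (Real.cosh x)⁻¹ with hK
  have hK0 : 0 ≤ K := integral_nonneg fun x => (inv_pos.2 (Real.cosh_pos x)).le
  -- After multiplication by η, the remainder 16Ke is at most e/4, below the residue's lower bound.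
  refine ⟨min (1 / 2) (1 / (64 * (K + 1))), by positivity, 4 + 16 * K, by positivity,
    fun α h0 h1 hη => ?_⟩
  have hη1 := hη.trans (min_le_left _ _)
  have hη2 := hη.trans (min_le_right _ _)
  refine ⟨hη1, fun ν hν => ?_⟩
  have hres := betaHat_residue h0 h1 hη1 hν
  have hη0 := sqrt_one_sub_sq_pos h0 h1
  have hsq := sq_sqrt_one_sub_sq h0 h1
  obtain ⟨c1, c2⟩ := cosh_rhoMinus_bounds h0 h1 hη1
  have c3 := cosh_rhoMinus_re_ge h0 h1 hη1
  obtain ⟨b1, b2⟩ := rhoMinus_im_bounds h0 h1 hη1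
  set η := √(1 - α ^ 2) with hηdef
  rw [← hK, ← hsq] at hres
  set b := (rhoMinus α).im with hb
  set B := ‖betaHat α ν‖ with hB
  set Z := (α * Complex.cosh (rhoMinus α) + ν * η * rhoSinh α) / Complex.cosh (rhoMinus α) with hZ
  have hαn : ‖(α : ℂ)‖ = α := by rw [Complex.norm_real, Real.norm_eq_abs, abs_of_pos h0]
  have hνn : ‖(ν : ℂ)‖ = ν := by rw [Complex.norm_real, Real.norm_eq_abs, abs_of_nonneg hν]
  have hηn : ‖(η : ℂ)‖ = η := by rw [Complex.norm_real, Real.norm_eq_abs, abs_of_pos hη0]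
  have hα2 : 1 / 2 ≤ α := by nlinarith
  have hνη : 0 ≤ ν * η := by positivity
  have hZu : ‖Z‖ ≤ 1 + ν * η := by
    rw [hZ, norm_div, div_le_iff₀ (by linarith)]
    refine (norm_add_le _ _).trans ?_
    rw [norm_mul, norm_mul, norm_mul, hαn, hνn, hηn, norm_rhoSinh h0 h1]
    nlinarith
  have hZl : (1 + ν * η) / 6 ≤ ‖Z‖ := by
    rw [hZ, norm_div, le_div_iff₀ (by linarith)]
    have c4 : ‖Complex.cosh (rhoMinus α)‖ ≤ 3 / 2 := by nlinarith
    -- Both summands have nonnegative real part, so the real part of the sum suffices.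
    have c5 : (1 + ν * η) / 4 ≤ ‖α * Complex.cosh (rhoMinus α) + ν * η * rhoSinh α‖ := by
      refine le_trans ?_ (Complex.re_le_norm _)
      rw [Complex.add_re, Complex.re_ofReal_mul, ← Complex.ofReal_mul, Complex.re_ofReal_mul]
      simp only [rhoSinh]
      nlinarith
    nlinarith
  set e := Real.exp (-(ν * b)) with he
  have he0 : 0 < e := Real.exp_pos _
  have hpi := Real.pi_gt_three
  have hpi4 := Real.pi_lt_four
  have hT : ‖(π / η : ℂ) * Complex.exp (Complex.I * ν * rhoMinus α) * Z‖ = π / η * e * ‖Z‖ := by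
    rw [norm_mul, norm_mul, norm_div, hηn, Complex.norm_real, Real.norm_eq_abs,
      abs_of_pos (by linarith), Complex.norm_exp]
    simp [he, hb]
  have hL : ‖2 * ((η ^ 2 : ℝ) : ℂ) * betaHat α ν‖ = 2 * η ^ 2 * B := by
    rw [norm_mul, norm_mul, Complex.norm_ofNat, Complex.norm_real, Real.norm_eq_abs,
      abs_of_pos (by positivity)]
  have hE : 4 * (1 + 2 * ν) * Real.exp (-(ν * (π / 2))) * K ≤ 16 * K * e := by
    have := one_add_mul_exp_le hν (by linarith : b ≤ 1)
    nlinarith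
  have hres2 := abs_le.1 ((abs_norm_sub_norm_le _ _).trans (hres.trans hE))
  rw [hL, hT] at hres2
  have hS : hatSize α ν = (1 + ν * η) * e / η ^ 3 := rfl
  have hx : 2 * η ^ 3 * B = η * (2 * η ^ 2 * B) := by ring
  have hy : η * (π / η * e * ‖Z‖) = π * (e * ‖Z‖) := by field_simp
  have hKη : η * (64 * (K + 1)) ≤ 1 := by rwa [le_div_iff₀ (by positivity)] at hη2
  have heZ : e * ((1 + ν * η) / 6) ≤ e * ‖Z‖ := mul_le_mul_of_nonneg_left hZl he0.le
  have heZ' : e * ‖Z‖ ≤ e * (1 + ν * η) := mul_le_mul_of_nonneg_left hZu he0.le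
  have heν : e ≤ e * (1 + ν * η) := le_mul_of_one_le_right he0.le (by linarith)
  have hηKe : η * (16 * K * e) ≤ e / 4 := by
    have h1 : e * (64 * (η * K)) ≤ e * 1 := mul_le_mul_of_nonneg_left (by linarith) he0.le
    linarith
  constructor
  · rw [hS, div_div, div_le_iff₀ (by positivity)]
    have : η * (π / η * e * ‖Z‖) - η * (16 * K * e) ≤ η * (2 * η ^ 2 * B) := by
      rw [← mul_sub]
      exact mul_le_mul_of_nonneg_left (by linarith [hres2.1]) hη0.le
    rw [hy, ← hx] at this
    have h8 : 3 * (e * ((1 + ν * η) / 6)) ≤ π * (e * ‖Z‖) :=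
      mul_le_mul hpi.le heZ (by positivity) (by linarith)
    linarith
  · rw [hS, mul_div_assoc', le_div_iff₀ (by positivity)]
    have : η * (2 * η ^ 2 * B) ≤ η * (π / η * e * ‖Z‖) + η * (16 * K * e) := by
      rw [← mul_add]
      exact mul_le_mul_of_nonneg_left (by linarith [hres2.2]) hη0.le
    rw [hy, ← hx] at this
    have h8 : π * (e * ‖Z‖) ≤ 4 * (e * (1 + ν * η)) := by
      apply mul_le_mul hpi4.le heZ' (by positivity) (by norm_num)
    have h9 : 0 ≤ K * (e * (1 + ν * η)) := by positivity
    linarith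

end QPMelnikov

/-! ### Fourier expansion of the Melnikov function on the torus -/

namespace QPMelnikov
open Filter Topology Set AddCircle

/-- The character `θ ↦ exp (i k · θ)` of the torus. -/
noncomputable def character (k : ℤ × ℤ) (θ : Circ × Circ) : ℂ := fourier k.1 θ.1 * fourier k.2 θ.2

lemma norm_fourier_apply (n : ℤ) (x : Circ) : ‖fourier n x‖ = 1 := by
  rw [fourier_apply, Circle.norm_coe]

lemma norm_character (k : ℤ × ℤ) (θ : Circ × Circ) : ‖character k θ‖ = 1 := by
  rw [character, norm_mul, norm_fourier_apply, norm_fourier_apply, mul_one]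

lemma continuous_character (k : ℤ × ℤ) : Continuous (character k) := by
  unfold character
  exact ((map_continuous (fourier k.1)).comp continuous_fst).mul
    ((map_continuous (fourier k.2)).comp continuous_snd)

lemma exists_norm_coeff_le {F : Circ × Circ → ℝ} {r₁ r₂ : ℝ} (h : CoeffDecay F r₁ r₂) :
    ∃ M > 0, ∀ k, ‖coeff F k‖ ≤ M * weight r₁ r₂ k := by
  obtain ⟨M, hM⟩ := h
  refine ⟨max M 1, by positivity, fun k => ?_⟩
  have := hM (mem_range_self k)
  rw [← div_le_iff₀ (show 0 < weight r₁ r₂ k from Real.exp_pos _)]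
  exact this.trans (le_max_left _ _)

lemma summable_norm_coeff {F : Circ × Circ → ℝ} {r₁ r₂ : ℝ} (hr₁ : 0 < r₁) (hr₂ : 0 < r₂)
    (h : CoeffDecay F r₁ r₂) : Summable fun k => ‖coeff F k‖ := by
  obtain ⟨M, -, hM⟩ := exists_norm_coeff_le h
  exact Summable.of_nonneg_of_le (fun _ => norm_nonneg _) hM ((summable_weight hr₁ hr₂).mul_left M)

/-- Pointwise convergence of an absolutely summable double Fourier series. -/
lemma hasSum_coeff_mul_character {F : Circ × Circ → ℝ} (hF : Continuous F)
    (hs : Summable fun k => ‖coeff F k‖) (θ : Circ × Circ) :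
    HasSum (fun k => coeff F k * character k θ) (F θ : ℂ) := by
  have hFc : Continuous fun θ : Circ × Circ => (F θ : ℂ) := Complex.continuous_ofReal.comp hF
  -- The series is summed one variable at a time: g n is the n-th coefficient in θ₂, as a continuous
  -- function of θ₁.
  set g : ℤ → C(Circ, ℂ) := fun n =>
    ⟨fun θ₁ => fourierCoeff (fun θ₂ : Circ => (F (θ₁, θ₂) : ℂ)) n, by
      unfold fourierCoeff
      simp_rw [← setIntegral_univ (μ := haarAddCircle)]
      apply continuous_parametric_integral_of_continuous
      · exact ((map_continuous (fourier (-n))).comp continuous_snd).smul hFc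
      · exact isCompact_univ⟩ with hg
  have hs' : Summable fun k : ℤ × ℤ => ‖coeff F (k.2, k.1)‖ := hs.prod_symm
  have hg1 : ∀ n (x : Circ), HasSum (fun m : ℤ => coeff F (m, n) * fourier m x) (g n x) := by
    intro n x
    have : Summable (fourierCoeff (g n)) := by
      apply Summable.of_norm
      exact hs'.prod_factor n
    exact has_pointwise_sum_fourier_series_of_summable this x
  have hs1 : Summable fun k : ℤ × ℤ => coeff F (k.2, k.1) * fourier k.2 θ.1 := by
    apply Summable.of_norm
    simpa only [norm_mul, norm_fourier_apply, mul_one] using hs'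
  have hs2 : Summable fun k : ℤ × ℤ => coeff F (k.2, k.1) * character (k.2, k.1) θ := by
    apply Summable.of_norm
    simpa only [norm_mul, norm_character, mul_one] using hs'
  let f : C(Circ, ℂ) := ⟨fun θ₂ => (F (θ.1, θ₂) : ℂ), by fun_prop⟩
  have hf : Summable (fourierCoeff f) := by
    have := hs1.prod
    simp_rw [fun n => (hg1 n θ.1).tsum_eq] at this
    exact this
  have h1 := has_pointwise_sum_fourier_series_of_summable hf θ.2
  have h2 := hs2.hasSum.prod_fiberwise (g := fun n => fourierCoeff f n • fourier n θ.2) fun n => by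
    have := (hg1 n θ.1).mul_right (fourier n θ.2)
    simp only [character, smul_eq_mul]
    simp_rw [← mul_assoc]
    exact this
  have h3 := hs2.hasSum
  rw [h2.unique h1] at h3
  exact (Equiv.prodComm ℤ ℤ).hasSum_iff.1 h3

lemma integral_character_mul (j k : ℤ × ℤ) :
    ∫ θ, character j θ * character (-k) θ ∂((haarAddCircle (T := 2 * π)).prod haarAddCircle)
      = if j = k then 1 else 0 := by
  have e : ∀ θ : Circ × Circ, character j θ * character (-k) θ
      = (fourier (-k.1) θ.1 • fourier j.1 θ.1) * (fourier (-k.2) θ.2 • fourier j.2 θ.2) := by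
    intro θ
    simp only [character, smul_eq_mul, Prod.fst_neg, Prod.snd_neg]
    ring
  simp_rw [e]
  rw [integral_prod_mul (fun x : Circ => fourier (-k.1) x • fourier j.1 x)
    (fun x : Circ => fourier (-k.2) x • fourier j.2 x)]
  have h1 := congrFun (fourierCoeff_fourier (T := 2 * π) j.1) k.1
  have h2 := congrFun (fourierCoeff_fourier (T := 2 * π) j.2) k.2
  unfold fourierCoeff at h1 h2
  rw [h1, h2]
  simp only [Pi.single_apply, Prod.ext_iff]
  by_cases e1 : j.1 = k.1 <;> by_cases e2 : j.2 = k.2 <;> simp [e1, e2, eq_comm]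

/-- A coefficient of an absolutely convergent series of characters is bounded by its supremum. -/
lemma norm_coefficient_le {a : ℤ × ℤ → ℂ} (ha : Summable fun k => ‖a k‖) {f : Circ × Circ → ℂ}
    (hf : ∀ θ, HasSum (fun k => a k * character k θ) (f θ)) {S : ℝ} (hS : ∀ θ, ‖f θ‖ ≤ S)
    (k : ℤ × ℤ) : ‖a k‖ ≤ S := by
  set μ := (haarAddCircle (T := 2 * π)).prod (haarAddCircle (T := 2 * π)) with hμ
  have hc : ∀ j, Continuous fun θ => a j * character j θ * character (-k) θ := fun j =>
    (continuous_const.mul (continuous_character j)).mul (continuous_character _)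
  have hn : ∀ j θ, ‖a j * character j θ * character (-k) θ‖ = ‖a j‖ := by
    intro j θ
    rw [norm_mul, norm_mul, norm_character, norm_character, mul_one, mul_one]
  have hn' : ∀ j, ∫ θ, ‖a j * character j θ * character (-k) θ‖ ∂μ = ‖a j‖ := by
    intro j
    simp_rw [hn]
    simp
  have h := hasSum_integral_of_summable_integral_norm (μ := μ)
    (F := fun j θ => a j * character j θ * character (-k) θ)
    (fun j => Integrable.mono' (integrable_const ‖a j‖) (hc j).aestronglyMeasurable
      (ae_of_all _ fun θ => (hn j θ).le)) (by simp_rw [hn']; exact ha)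
  have e1 : ∀ θ, ∑' j, a j * character j θ * character (-k) θ = f θ * character (-k) θ :=
    fun θ => ((hf θ).mul_right _).tsum_eq
  have e2 : ∀ j, ∫ θ, a j * character j θ * character (-k) θ ∂μ = if j = k then a k else 0 := by
    intro j
    simp_rw [mul_assoc]
    rw [integral_const_mul, integral_character_mul]
    split_ifs with hjk
    · rw [hjk, mul_one]
    · rw [mul_zero]
  simp_rw [e1, e2] at h
  rw [h.unique (hasSum_ite_eq k (a k)) |>.symm]
  refine (norm_integral_le_of_norm_le_const (C := S) (ae_of_all _ fun θ => ?_)).trans_eq ?_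
  · rw [norm_mul, norm_character, mul_one]
    exact hS θ
  · simp

lemma fourier_add_coe (n : ℤ) (x : Circ) (t : ℝ) :
    fourier n (x + (t : Circ)) = fourier n x * Complex.exp (Complex.I * n * t) := by
  have h : fourier n (t : Circ) = Complex.exp (Complex.I * n * t) := by
    rw [fourier_coe_apply]
    congr 1
    have := Real.pi_pos.ne'
    have : (π : ℂ) ≠ 0 := by exact_mod_cast this
    push_cast
    field_simp
  rw [← h]
  simp [fourier_apply, smul_add, toCircle_add]

lemma character_flow (k : ℤ × ℤ) (θ : Circ × Circ) (ε s : ℝ) :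
    character k (θ.1 + ((s / ε : ℝ) : Circ), θ.2 + ((Real.goldenRatio * s / ε : ℝ) : Circ))
      = character k θ * Complex.exp (Complex.I * ((freq k / ε : ℝ) : ℂ) * s) := by
  unfold character freq
  rw [fourier_add_coe, fourier_add_coe, mul_mul_mul_comm, ← Complex.exp_add]
  congr 2
  push_cast
  ring

/-- The `k`-th Fourier coefficient of the Melnikov function. -/
noncomputable def melnikovCoeff (F : Circ × Circ → ℝ) (ε α u : ℝ) (k : ℤ × ℤ) : ℂ :=
  4 * (coeff F k * (Complex.exp (-(Complex.I * ((freq k / ε : ℝ) : ℂ) * u))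
    * betaHat α (freq k / ε)))

lemma norm_melnikovCoeff (F : Circ × Circ → ℝ) (ε α u : ℝ) (k : ℤ × ℤ) :
    ‖melnikovCoeff F ε α u k‖ = 4 * (‖coeff F k‖ * ‖betaHat α (freq k / ε)‖) := by
  have : ‖Complex.exp (-(Complex.I * ((freq k / ε : ℝ) : ℂ) * u))‖ = 1 := by
    rw [Complex.norm_exp]; simp
  rw [melnikovCoeff, norm_mul, norm_mul, norm_mul, this, one_mul, Complex.norm_ofNat]

/-- β is real, so reflection is conjugation; this reduces the estimates to ν ≥ 0. -/
lemma norm_betaHat_neg (α ν : ℝ) : ‖betaHat α (-ν)‖ = ‖betaHat α ν‖ := by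
  have : betaHat α (-ν) = (starRingEnd ℂ) (betaHat α ν) := by
    unfold betaHat
    rw [← integral_conj]
    congr 1
    ext v
    rw [map_mul, Complex.conj_ofReal, ← Complex.exp_conj]
    simp
  rw [this, RCLike.norm_conj]

lemma norm_betaHat_abs (α ν : ℝ) : ‖betaHat α |ν|‖ = ‖betaHat α ν‖ := by
  rcases abs_choice ν with h | h <;> rw [h]
  exact norm_betaHat_neg α ν

lemma integral_beta_shift (α u ν : ℝ) :
    ∫ s : ℝ, (beta α (u + s) : ℂ) * Complex.exp (Complex.I * ν * s)
      = Complex.exp (-(Complex.I * ν * u)) * betaHat α ν := by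
  unfold betaHat
  rw [← integral_const_mul, ← integral_add_left_eq_self
    (fun v : ℝ => Complex.exp (-(Complex.I * ν * u)) *
      ((beta α v : ℂ) * Complex.exp (Complex.I * ν * v))) u]
  congr 1
  ext s
  rw [mul_left_comm, ← Complex.exp_add]
  congr 2
  push_cast
  ring

section Expansion

variable {F : Circ × Circ → ℝ} {ε α : ℝ}

lemma integrable_integrand (hF : Continuous F) (h0 : 0 < α) (h1 : α < 1) (u : ℝ)
    (θ : Circ × Circ) : Integrable (integrand F ε α u θ) := by
  obtain ⟨C, hC⟩ := isCompact_univ.exists_bound_of_continuousOn hF.continuousOn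
  unfold integrand
  refine ((integrable_beta h0 h1).comp_add_left u).mul_bdd (c := C) ?_
    (ae_of_all _ fun s => hC _ (mem_univ _))
  apply Continuous.aestronglyMeasurable
  apply hF.comp
  refine Continuous.prodMk ?_ ?_
  · exact continuous_const.add ((AddCircle.continuous_mk' _).comp (by fun_prop))
  · exact continuous_const.add ((AddCircle.continuous_mk' _).comp (by fun_prop))

lemma summable_norm_melnikovCoeff (hs : Summable fun k => ‖coeff F k‖) (h0 : 0 < α) (h1 : α < 1)
    (u : ℝ) : Summable fun k => ‖melnikovCoeff F ε α u k‖ := by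
  have hb : ∀ ν, ‖betaHat α ν‖ ≤ ∫ v, |beta α v| := by
    intro ν
    refine norm_integral_le_of_norm_le (integrable_beta h0 h1).abs (ae_of_all _ fun v => ?_)
    rw [norm_mul, norm_exp_I_mul, mul_one, Complex.norm_real, Real.norm_eq_abs]
  refine Summable.of_nonneg_of_le (fun _ => norm_nonneg _) (fun k => ?_)
    ((hs.mul_right (∫ v, |beta α v|)).mul_left 4)
  rw [norm_melnikovCoeff]
  gcongr
  exact hb _

/-- Along the flow the k-th character acquires the phase e^{i freq(k) s/ε}, so each term integrates
to a value of β̂. Absolute summability justifies the exchange. -/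
lemma hasSum_melnikov (hF : Continuous F) (hs : Summable fun k => ‖coeff F k‖) (h0 : 0 < α)
    (h1 : α < 1) (u : ℝ) (θ : Circ × Circ) :
    HasSum (fun k => melnikovCoeff F ε α u k * character k θ) (melnikov F ε α u θ : ℂ) := by
  have hβ : Integrable fun s => (beta α (u + s) : ℂ) :=
    ((integrable_beta h0 h1).comp_add_left u).ofReal
  set f : ℤ × ℤ → ℝ → ℂ := fun k s => coeff F k * character k θ *
    ((beta α (u + s) : ℂ) * Complex.exp (Complex.I * ((freq k / ε : ℝ) : ℂ) * s)) with hf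
  have hfi : ∀ k, Integrable (f k) := by
    intro k
    refine Integrable.const_mul (hβ.mul_bdd (c := 1) ?_ (ae_of_all _ fun v => ?_)) _
    · exact Continuous.aestronglyMeasurable (by fun_prop)
    · rw [norm_exp_I_mul]
  have hfn : ∀ k, ∫ s, ‖f k s‖ = ‖coeff F k‖ * ∫ s, |beta α (u + s)| := by
    intro k
    rw [← integral_const_mul]
    congr 1
    ext s
    simp only [hf]
    rw [norm_mul, norm_mul, norm_mul, norm_character, norm_exp_I_mul, Complex.norm_real,
      Real.norm_eq_abs, mul_one, mul_one]
  have h := hasSum_integral_of_summable_integral_norm hfi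
    (by simp_rw [hfn]; exact hs.mul_right _)
  have e1 : ∀ s, ∑' k, f k s = ((integrand F ε α u θ s : ℝ) : ℂ) := by
    intro s
    have := (hasSum_coeff_mul_character hF hs
      (θ.1 + ((s / ε : ℝ) : Circ), θ.2 + ((Real.goldenRatio * s / ε : ℝ) : Circ))).mul_left
      (beta α (u + s) : ℂ)
    rw [integrand, Complex.ofReal_mul, ← this.tsum_eq]
    congr 1
    ext k
    rw [character_flow]
    simp only [hf]
    ring
  have e2 : ∀ k, ∫ s, f k s = coeff F k * character k θ *
      (Complex.exp (-(Complex.I * ((freq k / ε : ℝ) : ℂ) * u)) * betaHat α (freq k / ε)) := by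
    intro k
    simp only [hf]
    rw [integral_const_mul, integral_beta_shift]
  simp_rw [e1, e2] at h
  rw [integral_complex_ofReal] at h
  have h4 := h.mul_left 4
  rw [melnikov, Complex.ofReal_mul]
  have e4 : ((4 : ℝ) : ℂ) = 4 := by norm_num
  rw [e4]
  refine h4.congr_fun fun k => ?_
  rw [melnikovCoeff]
  ring

lemma abs_melnikov_le (hF : Continuous F) (hs : Summable fun k => ‖coeff F k‖) (h0 : 0 < α)
    (h1 : α < 1) (u : ℝ) (θ : Circ × Circ) :
    |melnikov F ε α u θ| ≤ ∑' k, 4 * (‖coeff F k‖ * ‖betaHat α (freq k / ε)‖) := by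
  have h := hasSum_melnikov (ε := ε) hF hs h0 h1 u θ
  have h2 := summable_norm_melnikovCoeff (ε := ε) hs h0 h1 u
  rw [← Real.norm_eq_abs, ← Complex.norm_real, ← h.tsum_eq]
  refine (norm_tsum_le_tsum_norm ?_).trans_eq ?_
  · simpa [norm_character] using h2
  · simp_rw [norm_mul, norm_character, mul_one, norm_melnikovCoeff]

lemma bddAbove_absValues (hF : Continuous F) (hs : Summable fun k => ‖coeff F k‖) (h0 : 0 < α)
    (h1 : α < 1) (u₀ : ℝ) : BddAbove (absValues F ε α u₀) := by
  refine ⟨∑' k, 4 * (‖coeff F k‖ * ‖betaHat α (freq k / ε)‖), ?_⟩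
  rintro x ⟨u, -, θ, rfl⟩
  exact abs_melnikov_le hF hs h0 h1 u θ

lemma sSup_absValues_le (hF : Continuous F) (hs : Summable fun k => ‖coeff F k‖) (h0 : 0 < α)
    (h1 : α < 1) {u₀ : ℝ} (hu₀ : 0 < u₀) {g : ℤ × ℤ → ℝ} (hg : Summable g)
    (hle : ∀ k, 4 * (‖coeff F k‖ * ‖betaHat α (freq k / ε)‖) ≤ g k) :
    sSup (absValues F ε α u₀) ≤ ∑' k, g k := by
  apply csSup_le
  · exact ⟨_, 0, ⟨by linarith, hu₀⟩, 0, rfl⟩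
  · rintro x ⟨u, -, θ, rfl⟩
    refine (abs_melnikov_le hF hs h0 h1 u θ).trans (Summable.tsum_le_tsum hle ?_ hg)
    exact Summable.of_nonneg_of_le (fun _ => by positivity) hle hg

/-- Varying u changes only the phase of each coefficient, so the slice u = 0 is enough. -/
lemma le_sSup_absValues (hF : Continuous F) (hs : Summable fun k => ‖coeff F k‖) (h0 : 0 < α)
    (h1 : α < 1) {u₀ : ℝ} (hu₀ : 0 < u₀) (k : ℤ × ℤ) :
    4 * (‖coeff F k‖ * ‖betaHat α (freq k / ε)‖) ≤ sSup (absValues F ε α u₀) := by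
  rw [← norm_melnikovCoeff F ε α 0 k]
  refine norm_coefficient_le (summable_norm_melnikovCoeff hs h0 h1 0)
    (hasSum_melnikov hF hs h0 h1 0) (fun θ => ?_) k
  rw [Complex.norm_real, Real.norm_eq_abs]
  exact le_csSup (bddAbove_absValues hF hs h0 h1 u₀) ⟨0, ⟨by linarith, hu₀⟩, θ, rfl⟩

end Expansion

end QPMelnikov

/-! ### Choice of the dominant scale and the two regimes -/

namespace QPMelnikov
open Filter Topology Set
open scoped goldenRatio

lemma goldenRatio_add_inv : φ + φ⁻¹ = √5 := by
  rw [inv_goldenRatio, ← goldenRatio_sub_goldenConj]; ring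

/-- The exponent `c(ln (1/p)) √p` is attained at an optimal power of the golden mean. -/
lemma exists_zpow_cFun {r₁ r₂ p : ℝ} (hr₁ : 0 < r₁) (hr₂ : 0 < r₂) (hp : 0 < p) :
    ∃ n : ℤ, cFun r₁ r₂ (-Real.log p) * √p = unitRate r₁ r₂ * φ ^ n + p / φ ^ n ∧
      unitRate r₁ r₂ * φ ^ n ≤ φ * (p / φ ^ n) ∧ p / φ ^ n ≤ φ * (unitRate r₁ r₂ * φ ^ n) := by
  have hφ := goldenRatio_pos
  have hA := unitRate_pos hr₁ hr₂
  set A := unitRate r₁ r₂ with hAdef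
  set L := Real.log φ with hL
  have hamp : cAmp r₁ r₂ = 2 * √A := by
    rw [cAmp, goldenRatio_add_inv, hAdef, unitRate, mul_comm φ r₁]
  have hshift : cShift r₁ r₂ = -(2 * L) - Real.log A := by
    have e : (φ + φ⁻¹) / (φ ^ 2 * (r₁ * φ + r₂)) = (φ ^ 2 * A)⁻¹ := by
      rw [goldenRatio_add_inv, hAdef, unitRate]
      field_simp
    rw [cShift, e, Real.log_inv, Real.log_mul (by positivity) hA.ne', Real.log_pow]
    push_cast
    ring
  set m := toIcoDiv two_log_golden_pos (cShift r₁ r₂ - L) (-Real.log p) with hm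
  have hmod : toIcoMod two_log_golden_pos (cShift r₁ r₂ - L) (-Real.log p)
      = -Real.log p - m * (2 * L) := by
    rw [toIcoMod, ← hm, zsmul_eq_mul]
  have hmem := toIcoMod_mem_Ico two_log_golden_pos (cShift r₁ r₂ - L) (-Real.log p)
  -- P and Q will be √(Ap) e^{±t}. One period of c is exactly the range |t| ≤ (ln φ)/2, i.e. P/Q
  -- between φ⁻¹ and φ.
  set t := (toIcoMod two_log_golden_pos (cShift r₁ r₂ - L) (-Real.log p) - cShift r₁ r₂) / 2 with ht
  have ht1 : -(L / 2) ≤ t := by rw [ht]; linarith [hmem.1]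
  have ht2 : t ≤ L / 2 := by rw [ht]; linarith [hmem.2]
  have htv : t = (1 - m) * L + Real.log A / 2 - Real.log p / 2 := by
    rw [ht, hmod, hshift]; ring
  have hc : cFun r₁ r₂ (-Real.log p) = 2 * √A * Real.cosh t := by
    rw [cFun, hamp]
  have hX : φ ^ (1 - m) = Real.exp ((1 - m) * L) := by
    rw [← Real.rpow_intCast, Real.rpow_def_of_pos hφ, hL]
    push_cast
    ring_nf
  have hsA : √A = Real.exp (Real.log A / 2) := by
    rw [Real.exp_half, Real.exp_log hA]
  have hsp : √p = Real.exp (Real.log p / 2) := by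
    rw [Real.exp_half, Real.exp_log hp]
  have hP : A * φ ^ (1 - m) = √A * √p * Real.exp t := by
    rw [hX, hsA, hsp, ← Real.exp_add, ← Real.exp_add, htv]
    conv_lhs => rw [← Real.exp_log hA, ← Real.exp_add]
    ring_nf
  have hQ : p / φ ^ (1 - m) = √A * √p * Real.exp (-t) := by
    rw [hX, hsA, hsp, ← Real.exp_add, ← Real.exp_add, htv, div_eq_mul_inv, ← Real.exp_neg]
    conv_lhs => rw [← Real.exp_log hp, ← Real.exp_add]
    ring_nf
  have hφe : φ = Real.exp L := (Real.exp_log hφ).symm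
  refine ⟨1 - m, ?_, ?_, ?_⟩
  · rw [hP, hQ, hc, Real.cosh_eq]; ring
  · rw [hP, hQ, mul_left_comm]
    refine mul_le_mul_of_nonneg_left ?_ (by positivity)
    nth_rewrite 1 [hφe]
    rw [← Real.exp_add, Real.exp_le_exp]
    linarith
  · rw [hP, hQ, mul_left_comm]
    refine mul_le_mul_of_nonneg_left ?_ (by positivity)
    nth_rewrite 1 [hφe]
    rw [← Real.exp_add, Real.exp_le_exp]
    linarith

/-- The resonances `(-fib (n + 1), fib n)` satisfy the lower bound on the Fourier coefficients. -/
lemma norm_coeff_fib_ge {F : Circ × Circ → ℝ} {r₁ r₂ a : ℝ} {k₀ : ℕ}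
    (hlower : CoeffLower F r₁ r₂ a k₀) {n : ℕ} (hn : k₀ + 5 ≤ n) :
    a * weight r₁ r₂ (-(Nat.fib (n + 1) : ℤ), (Nat.fib n : ℤ))
      ≤ ‖coeff F (-(Nat.fib (n + 1) : ℤ), (Nat.fib n : ℤ))‖ := by
  -- The shift by 5 ensures n ≤ fib n, hence fib n > k₀. The ratio fib(n+1)/fib n is the convergent
  -- of index n - 1.
  have hfib : n ≤ Nat.fib n := Nat.le_fib_self (by omega)
  have h := hlower (-(Nat.fib (n + 1) : ℤ), (Nat.fib n : ℤ)) ?_ ⟨n - 1, ?_⟩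
  · exact h.2.le.trans (Complex.re_le_norm _)
  · simp only [Nat.abs_cast]
    exact_mod_cast (by omega : k₀ < Nat.fib n)
  · rw [convergent_goldenRatio, show n - 1 + 2 = n + 1 by omega, show n - 1 + 1 = n by omega]
    push_cast
    rw [abs_neg, Nat.abs_cast, Nat.abs_cast]

/-- Here 1 - α² = Cx⁴(2 - Cx⁴). With x = ε^{r/4} this gives the order ε^{r/2} of η. -/
lemma sqrt_one_sub_sq_scale {C x : ℝ} (hC : 0 < C) (hx : 0 < x) (h : C * x ^ 4 < 1) :
    √C * x ^ 2 ≤ √(1 - (1 - C * x ^ 4) ^ 2) ∧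
      √(1 - (1 - C * x ^ 4) ^ 2) ≤ 2 * (√C * x ^ 2) := by
  have hx4 : 0 < C * x ^ 4 := by positivity
  have hs := Real.sq_sqrt hC.le
  constructor
  · apply Real.le_sqrt_of_sq_le
    rw [mul_pow, hs, ← pow_mul, show 2 * 2 = 4 from rfl]
    nlinarith
  · rw [Real.sqrt_le_left (by positivity), mul_pow, mul_pow, hs, ← pow_mul, show 2 * 2 = 4 from rfl]
    nlinarith

lemma tendsto_rpow_nhdsGT_zero {r : ℝ} (hr : 0 < r) :
    Tendsto (fun ε : ℝ => ε ^ r) (𝓝[>] 0) (𝓝 0) := by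
  have := (Real.continuousAt_rpow_const 0 r (Or.inr hr.le)).tendsto
  rw [Real.zero_rpow hr.ne'] at this
  exact this.mono_left nhdsWithin_le_nhds

/-- Trading η for the comparable b in the prefactor makes it and the exponential functions of the
single variable νb. -/
lemma hatSize_le {α : ℝ} (h0 : 0 < α) (h1 : α < 1) (hη : √(1 - α ^ 2) ≤ 1 / 2) {ν : ℝ}
    (hν : 0 ≤ ν) : hatSize α ν ≤
      2 * ((1 + ν * (rhoMinus α).im) * Real.exp (-(ν * (rhoMinus α).im))) / √(1 - α ^ 2) ^ 3 := by
  have hη0 := sqrt_one_sub_sq_pos h0 h1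
  have hb := (rhoMinus_im_bounds h0 h1 hη).1
  unfold hatSize
  rw [← mul_assoc]
  gcongr
  nlinarith

lemma le_hatSize {α : ℝ} (h0 : 0 < α) (h1 : α < 1) (hη : √(1 - α ^ 2) ≤ 1 / 2) {ν : ℝ}
    (hν : 0 ≤ ν) : (1 + ν * (rhoMinus α).im) / 2 * Real.exp (-(ν * (rhoMinus α).im))
      / √(1 - α ^ 2) ^ 3 ≤ hatSize α ν := by
  have hη0 := sqrt_one_sub_sq_pos h0 h1
  have hb := (rhoMinus_im_bounds h0 h1 hη).2
  unfold hatSize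
  gcongr
  nlinarith

lemma eventually_small {C r η₀ : ℝ} (hr : 0 < r) (hη₀ : 0 < η₀) :
    ∀ᶠ ε : ℝ in 𝓝[>] 0, C * ε ^ r < 1 / 2 ∧ √(1 - (1 - C * ε ^ r) ^ 2) ≤ η₀ := by
  have h := (tendsto_rpow_nhdsGT_zero hr).const_mul C
  rw [mul_zero] at h
  have h2 : Tendsto (fun ε : ℝ => √(1 - (1 - C * ε ^ r) ^ 2)) (𝓝[>] 0) (𝓝 0) := by
    have := ((tendsto_const_nhds (x := (1 : ℝ))).sub
      (((tendsto_const_nhds (x := (1 : ℝ))).sub h).pow 2)).sqrt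
    simpa using this
  exact (h.eventually_lt_const (by norm_num)).and (h2.eventually_le_const hη₀)

section Regimes

variable {F : Circ × Circ → ℝ} {r₁ r₂ a u₀ C r : ℝ} {k₀ : ℕ}

lemma one_add_mul_exp_neg_le {x : ℝ} : (1 + x) * Real.exp (-x) ≤ 1 := by
  rw [Real.exp_neg, ← div_eq_mul_inv, div_le_one (Real.exp_pos x), add_comm]
  exact Real.add_one_le_exp x

theorem sSup_absValues_algebraic (hF : Continuous F) (hr₁ : 0 < r₁) (hr₂ : 0 < r₂)
    (hdecay : CoeffDecay F r₁ r₂) (ha : 0 < a) (hlower : CoeffLower F r₁ r₂ a k₀) (hu₀ : 0 < u₀)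
    (hC : 0 < C) (hr : 2 ≤ r) :
    ∃ C₁ > 0, ∃ C₂ > 0, ∀ᶠ ε : ℝ in 𝓝[>] 0, 0 < 1 - C * ε ^ r ∧ 1 - C * ε ^ r < 1 ∧
      C₁ / ε ^ (3 * r / 2) ≤ sSup (absValues F ε (1 - C * ε ^ r) u₀) ∧
      sSup (absValues F ε (1 - C * ε ^ r) u₀) ≤ C₂ / ε ^ (3 * r / 2) := by
  obtain ⟨η₀, hη₀, D, hD, hB⟩ := betaHat_bounds
  have hs := summable_norm_coeff hr₁ hr₂ hdecay
  set k : ℤ × ℤ := (-(Nat.fib (k₀ + 5 + 1) : ℤ), (Nat.fib (k₀ + 5) : ℤ)) with hk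
  have hck := norm_coeff_fib_ge hlower (le_refl (k₀ + 5))
  rw [← hk] at hck
  have hw : 0 < weight r₁ r₂ k := Real.exp_pos _
  have hck0 : 0 < ‖coeff F k‖ := lt_of_lt_of_le (by positivity) hck
  have hκ : 0 < √C := Real.sqrt_pos.2 hC
  have hW : 0 ≤ ∑' k, ‖coeff F k‖ := tsum_nonneg fun _ => norm_nonneg _
  -- The number 4√C bounds b/ε, through b ≤ 2η ≤ 4√C x² and x² ≤ ε. The added 1 only makes the
  -- second constant positive.
  refine ⟨4 * (‖coeff F k‖ * (Real.exp (-(|freq k| * (4 * √C))) / 2 / (2 * √C) ^ 3 / 8)),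
    by positivity, 4 * ((∑' k, ‖coeff F k‖) * (D * 2 / √C ^ 3)) + 1, by positivity, ?_⟩
  filter_upwards [eventually_small (C := C) (by linarith : 0 < r) hη₀, self_mem_nhdsWithin,
    Ioo_mem_nhdsGT (zero_lt_one' ℝ)] with ε ⟨hε1, hε2⟩ hε0 hε3
  simp only [mem_Ioi] at hε0
  set x := ε ^ (r / 4) with hx
  have hx0 : 0 < x := Real.rpow_pos_of_pos hε0 _
  have e1 : ε ^ r = x ^ 4 := by
    rw [hx, ← Real.rpow_natCast, ← Real.rpow_mul hε0.le]; congr 1; push_cast; ring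
  have e2 : ε ^ (3 * r / 2) = (x ^ 2) ^ 3 := by
    rw [hx, ← pow_mul, ← Real.rpow_natCast, ← Real.rpow_mul hε0.le]; congr 1; push_cast; ring
  -- This is where r ≥ 2 enters.
  have e3 : x ^ 2 ≤ ε := by
    rw [hx, ← Real.rpow_natCast, ← Real.rpow_mul hε0.le]
    refine (Real.rpow_le_rpow_of_exponent_ge hε0 hε3.2.le (show 1 ≤ r / 4 * (2 : ℕ) by
      push_cast; linarith)).trans_eq (Real.rpow_one ε)
  rw [e1] at hε1 hε2 ⊢
  rw [e2]
  obtain ⟨s1, s2⟩ := sqrt_one_sub_sq_scale hC hx0 (by linarith)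
  have hα0 : 0 < 1 - C * x ^ 4 := by linarith
  have hα1 : 1 - C * x ^ 4 < 1 := by
    have : 0 < C * x ^ 4 := by positivity
    linarith
  set α := 1 - C * x ^ 4 with hα
  obtain ⟨hη, hB⟩ := hB α hα0 hα1 hε2
  obtain ⟨-, b2⟩ := rhoMinus_im_bounds hα0 hα1 hη
  have hb0 := (rhoMinus_im_mem hα0 hα1).1
  have hη0 := sqrt_one_sub_sq_pos hα0 hα1
  refine ⟨hα0, hα1, ?_, ?_⟩
  · refine le_trans ?_ (le_sSup_absValues hF hs hα0 hα1 hu₀ k)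
    have hν : 0 ≤ |freq k| / ε := by positivity
    have h1 := (hB _ hν).1
    have h2 := le_hatSize hα0 hα1 hη hν
    have h3 : |freq k| / ε * (rhoMinus α).im ≤ |freq k| * (4 * √C) := by
      rw [div_mul_eq_mul_div, div_le_iff₀ hε0, mul_assoc]
      refine mul_le_mul_of_nonneg_left ?_ (abs_nonneg _)
      nlinarith
    rw [← norm_betaHat_abs, abs_div, abs_of_pos hε0]
    have h4 : Real.exp (-(|freq k| * (4 * √C))) / 2 / (2 * (√C * x ^ 2)) ^ 3
        ≤ hatSize α (|freq k| / ε) := by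
      refine le_trans ?_ h2
      have h5 : 0 ≤ |freq k| / ε * (rhoMinus α).im := by positivity
      rw [div_mul_eq_mul_div]
      gcongr
      calc Real.exp (-(|freq k| * (4 * √C)))
          ≤ 1 * Real.exp (-(|freq k| / ε * (rhoMinus α).im)) := by
            rw [one_mul, Real.exp_le_exp]; linarith
        _ ≤ _ := by gcongr; linarith
    calc _ = 4 * (‖coeff F k‖ *
          (Real.exp (-(|freq k| * (4 * √C))) / 2 / (2 * (√C * x ^ 2)) ^ 3 / 8)) := by
          field_simp
      _ ≤ _ := by gcongr; linarith
  · have hle : ∀ j, 4 * (‖coeff F j‖ * ‖betaHat α (freq j / ε)‖)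
        ≤ 4 * (‖coeff F j‖ * (D * 2 / (√C * x ^ 2) ^ 3)) := by
      intro j
      rw [← norm_betaHat_abs]
      gcongr
      have hν := abs_nonneg (freq j / ε)
      refine (hB _ hν).2.trans ?_
      rw [mul_div_assoc]
      gcongr
      refine (hatSize_le hα0 hα1 hη hν).trans ?_
      have := one_add_mul_exp_neg_le (x := |freq j / ε| * (rhoMinus α).im)
      gcongr
      linarith
    refine (sSup_absValues_le hF hs hα0 hα1 hu₀ ((hs.mul_right _).mul_left 4) hle).trans ?_
    rw [tsum_mul_left, tsum_mul_right, add_div]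
    have h9 : 0 ≤ 1 / (x ^ 2) ^ 3 := by positivity
    refine le_trans (le_of_eq ?_) (le_add_of_nonneg_right h9)
    field_simp

theorem sSup_absValues_exponential (hF : Continuous F) (hr₁ : 0 < r₁) (hr₂ : 0 < r₂)
    (hdecay : CoeffDecay F r₁ r₂) (ha : 0 < a) (hlower : CoeffLower F r₁ r₂ a k₀) (hu₀ : 0 < u₀)
    (hC : 0 < C) (hr0 : 0 < r) (hr : r < 2) (hmean : coeff F (0, 0) = 0) :
    ∃ C₁ > 0, ∃ C₂ > 0, ∀ᶠ ε : ℝ in 𝓝[>] 0, 0 < 1 - C * ε ^ r ∧ 1 - C * ε ^ r < 1 ∧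
      C₁ * expSmallSize r₁ r₂ r ε (1 - C * ε ^ r)
        ≤ sSup (absValues F ε (1 - C * ε ^ r) u₀) ∧
      sSup (absValues F ε (1 - C * ε ^ r) u₀)
        ≤ C₂ * expSmallSize r₁ r₂ r ε (1 - C * ε ^ r) := by
  obtain ⟨η₀, hη₀, D, hD, hB⟩ := betaHat_bounds
  obtain ⟨M, hM0, hM⟩ := exists_norm_coeff_le hdecay
  have hs := summable_norm_coeff hr₁ hr₂ hdecay
  have hκ : 0 < √C := Real.sqrt_pos.2 hC
  have hφ := goldenRatio_pos
  have hφ1 := one_lt_goldenRatio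
  have hφ2 := goldenRatio_lt_two
  have hA := unitRate_pos hr₁ hr₂
  set A := unitRate r₁ r₂ with hAdef
  have hws := summable_exp_size (c := 1 / 2) (by norm_num)
  set W := ∑' k : ℤ × ℤ, Real.exp (-(1 / 2) * (|freqConj k| + |freq k|)) with hW
  have hW0 : 0 ≤ W := tsum_nonneg fun _ => (Real.exp_pos _).le
  -- The first bound lets the weight error be absorbed; the second puts the optimal unit among the
  -- resonances covered by the lower hypothesis.
  set X₀ : ℝ := max (8 * (r₁ + r₂)) (φ ^ (k₀ + 5)) with hX₀
  have hX₀pos : 0 < X₀ := lt_of_lt_of_le (by positivity) (le_max_left _ _)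
  -- Since Ap ≤ 2P² and Ap ≤ 2Q², the condition p ≥ T forces Q ≥ 1 and X ≥ X₀.
  set T : ℝ := 2 * (1 + X₀ ^ 2 * A ^ 2) / A with hT
  have hT0 : 0 < T := by positivity
  set c₁ : ℝ := √(A * √C / 4) / (2 * √C) ^ 3 with hc₁
  set c₂ : ℝ := √(8 * A * √C) / √C ^ 3 with hc₂
  have hc₁0 : 0 < c₁ := by positivity
  have hc₂0 : 0 < c₂ := by positivity
  set K₁ : ℝ := a * Real.exp (-(r₁ + r₂)) / 8 with hK₁
  set K₂ : ℝ := 64 * M * D * Real.exp 3 * W with hK₂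
  have hK₂0 : 0 ≤ K₂ := by positivity
  refine ⟨K₁ * c₁ / 2, by positivity, K₂ * c₂ + 1, by positivity, ?_⟩
  -- This is where r < 2 enters: p is at least of order ε^{r/2-1}, which eventually exceeds T.
  have hsmall := (tendsto_rpow_nhdsGT_zero (show 0 < 1 - r / 2 by linarith)).eventually_le_const
    (show 0 < √C / (2 * T) by positivity)
  filter_upwards [eventually_small (C := C) hr0 hη₀, self_mem_nhdsWithin, hsmall] with ε ⟨hε1, hε2⟩ hε0 hε3
  simp only [mem_Ioi] at hε0
  set x := ε ^ (r / 4) with hx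
  set s := ε ^ (1 / 2 : ℝ) with hsdef
  have hx0 : 0 < x := Real.rpow_pos_of_pos hε0 _
  have hs0 : 0 < s := Real.rpow_pos_of_pos hε0 _
  have e1 : ε ^ r = x ^ 4 := by
    rw [hx, ← Real.rpow_natCast, ← Real.rpow_mul hε0.le]; congr 1; push_cast; ring
  have e2 : ε ^ (1 / 2 + 5 * r / 4) = s * x ^ 5 := by
    rw [Real.rpow_add hε0, hx, ← Real.rpow_natCast, ← Real.rpow_mul hε0.le]
    congr 2; push_cast; ring
  have e3 : s ^ 2 = ε := by
    rw [hsdef, ← Real.rpow_natCast, ← Real.rpow_mul hε0.le]; norm_num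
  have e4 : ε ^ (1 - r / 2) = s ^ 2 / x ^ 2 := by
    rw [e3, Real.rpow_sub hε0, Real.rpow_one, hx, ← Real.rpow_natCast, ← Real.rpow_mul hε0.le]
    congr 2; push_cast; ring
  rw [e4] at hε3
  rw [e1] at hε1 hε2 ⊢
  obtain ⟨s1, s2⟩ := sqrt_one_sub_sq_scale hC hx0 (by linarith)
  have hα0 : 0 < 1 - C * x ^ 4 := by linarith
  have hα1 : 1 - C * x ^ 4 < 1 := by
    have : 0 < C * x ^ 4 := by positivity
    linarith
  have hα2 : 1 / 2 ≤ 1 - C * x ^ 4 := by linarith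
  set α := 1 - C * x ^ 4 with hα
  obtain ⟨hη, hB⟩ := hB α hα0 hα1 hε2
  obtain ⟨b1, b2⟩ := rhoMinus_im_bounds hα0 hα1 hη
  have hb0 := (rhoMinus_im_mem hα0 hα1).1
  have hη0 := sqrt_one_sub_sq_pos hα0 hα1
  have hlow := fun ν hν => le_hatSize (ν := ν) hα0 hα1 hη hν
  have hupp := fun ν hν => hatSize_le (ν := ν) hα0 hα1 hη hν
  set η := √(1 - α ^ 2) with hηdef
  set b := (rhoMinus α).im with hb
  set p := b / ε with hp
  have hp0 : 0 < p := by positivity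
  have hp1 : √C / 2 * (x / s) ^ 2 ≤ p := by
    rw [hp, ← e3, le_div_iff₀ (by positivity)]
    field_simp
    linarith
  have hp2 : p ≤ 4 * √C * (x / s) ^ 2 := by
    rw [hp, ← e3, div_le_iff₀ (by positivity)]
    field_simp
    linarith
  have hpT : T ≤ p := by
    refine le_trans ?_ hp1
    rw [div_le_div_iff₀ (by positivity) (by positivity)] at hε3
    rw [div_pow, div_mul_div_comm, le_div_iff₀ (by positivity)]
    linarith
  obtain ⟨n, hn1, hn2, hn3⟩ := exists_zpow_cFun hr₁ hr₂ hp0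
  rw [← hAdef] at hn1 hn2 hn3
  set X := φ ^ n with hX
  have hX0 : 0 < X := zpow_pos hφ n
  set P := A * X with hP
  set Q := p / X with hQ
  have hP0 : 0 < P := by positivity
  have hQ0 : 0 < Q := by positivity
  have hPQ : P * Q = A * p := by rw [hP, hQ]; field_simp
  have hAT : 2 * (1 + X₀ ^ 2 * A ^ 2) ≤ A * p := by
    have := mul_le_mul_of_nonneg_left hpT hA.le
    rwa [hT, mul_div_cancel₀ _ hA.ne'] at this
  have hQP' : Q ≤ 2 * P := hn3.trans (mul_le_mul_of_nonneg_right hφ2.le hP0.le)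
  have hPQ' : P ≤ 2 * Q := hn2.trans (mul_le_mul_of_nonneg_right hφ2.le hQ0.le)
  have hPs : A * p ≤ 2 * P ^ 2 := by
    have := mul_le_mul_of_nonneg_left hQP' hP0.le
    linarith
  have hQs : A * p ≤ 2 * Q ^ 2 := by
    have := mul_le_mul_of_nonneg_right hPQ' hQ0.le
    linarith
  have hQs2 : Q ^ 2 ≤ 2 * (A * p) := by
    have := mul_le_mul_of_nonneg_right hQP' hQ0.le
    linarith
  have hXA : 0 ≤ X₀ ^ 2 * A ^ 2 := by positivity
  have hQ1 : 1 ≤ Q := (abs_le_of_sq_le_sq' (by linarith) hQ0.le).2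
  have hXX : X₀ ≤ X := by
    have : (X₀ * A) ^ 2 ≤ P ^ 2 := by rw [mul_pow]; linarith
    have := (sq_le_sq₀ (by positivity) hP0.le).1 this
    rw [hP, mul_comm A] at this
    exact le_of_mul_le_mul_right this hA
  have hsize : expSmallSize r₁ r₂ r ε α = 1 / (√α * (s * x ^ 5)) * Real.exp (-(P + Q)) := by
    have hlog : Real.log (ε / b) = -Real.log p := by
      rw [hp, ← Real.log_inv, inv_div]
    rw [expSmallSize, ← hb, hlog, e2, neg_mul, hn1]
  -- Q is of order √(Ap), hence of order x/s, and η is of order x²; so Q/η³ has order 1/(s x⁵).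
  have hQη1 : c₁ / (s * x ^ 5) ≤ Q / η ^ 3 := by
    have h1 : √(A * √C / 4) * (x / s) ≤ Q := by
      refine abs_le_of_sq_le_sq' ?_ hQ0.le |>.2
      rw [mul_pow, Real.sq_sqrt (by positivity)]
      have := mul_le_mul_of_nonneg_left hp1 hA.le
      linarith
    calc c₁ / (s * x ^ 5) = √(A * √C / 4) * (x / s) / (2 * (√C * x ^ 2)) ^ 3 := by
          rw [hc₁]; field_simp
      _ ≤ _ := by gcongr
  have hQη2 : Q / η ^ 3 ≤ c₂ / (s * x ^ 5) := by
    have h1 : Q ≤ √(8 * A * √C) * (x / s) := by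
      refine abs_le_of_sq_le_sq' ?_ (by positivity) |>.2
      rw [mul_pow, Real.sq_sqrt (by positivity)]
      have := mul_le_mul_of_nonneg_left hp2 hA.le
      linarith
    calc Q / η ^ 3 ≤ √(8 * A * √C) * (x / s) / (√C * x ^ 2) ^ 3 := by gcongr
      _ = _ := by rw [hc₂]; field_simp
  have hsα1 : √α ≤ 1 := Real.sqrt_le_one.2 hα1.le
  have hsα2 : 1 / 2 ≤ √α := Real.le_sqrt_of_sq_le (by linarith)
  refine ⟨hα0, hα1, ?_, ?_⟩
  · have hn0 : ((k₀ + 5 : ℕ) : ℤ) ≤ n := by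
      rw [← zpow_le_zpow_iff_right₀ hφ1, zpow_natCast]
      exact (le_max_right _ _).trans hXX
    obtain ⟨m, hm⟩ := Int.eq_ofNat_of_zero_le (le_trans (Int.natCast_nonneg _) hn0)
    have hm5 : k₀ + 5 ≤ m := by exact_mod_cast hm ▸ hn0
    have hXm : X = φ ^ m := by rw [hX, hm, zpow_natCast]
    have hcoeff := norm_coeff_fib_ge hlower hm5
    have hweight := weight_fib_ge hr₁ hr₂ m
    have hfreq := abs_freq_fib m
    rw [← hXm] at hweight hfreq
    set k : ℤ × ℤ := (-(Nat.fib (m + 1) : ℤ), (Nat.fib m : ℤ))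
    refine le_trans ?_ (le_sSup_absValues hF hs hα0 hα1 hu₀ k)
    rw [← norm_betaHat_abs, abs_div, abs_of_pos hε0, hfreq]
    have hν : 0 ≤ X⁻¹ / ε := by positivity
    have h1 := hlow _ hν
    have h2 := (hB _ hν).1
    have h3 : X⁻¹ / ε * b = Q := by rw [hQ, hp]; field_simp
    rw [h3] at h1
    have h4 : Q / 2 * Real.exp (-Q) / η ^ 3 ≤ hatSize α (X⁻¹ / ε) := by
      refine le_trans ?_ h1
      gcongr
      linarith
    have h5 : a * (Real.exp (-(r₁ + r₂)) * Real.exp (-P)) ≤ ‖coeff F k‖ :=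
      (mul_le_mul_of_nonneg_left hweight ha.le).trans hcoeff
    rw [hsize]
    calc K₁ * c₁ / 2 * (1 / (√α * (s * x ^ 5)) * Real.exp (-(P + Q)))
        = K₁ * (1 / 2 / √α) * (c₁ / (s * x ^ 5)) * Real.exp (-(P + Q)) := by field_simp
      _ ≤ K₁ * 1 * (Q / η ^ 3) * Real.exp (-(P + Q)) := by
          gcongr
          rw [div_le_one (by positivity)]
          exact hsα2
      _ ≤ 2 * (K₁ * 1 * (Q / η ^ 3) * Real.exp (-(P + Q))) := by
          have : 0 ≤ K₁ * 1 * (Q / η ^ 3) * Real.exp (-(P + Q)) := by positivity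
          linarith
      _ = 4 * (a * (Real.exp (-(r₁ + r₂)) * Real.exp (-P)) *
            (Q / 2 * Real.exp (-Q) / η ^ 3 / 8)) := by
          rw [hK₁, neg_add P Q, Real.exp_add]
          field_simp
          norm_num
      _ ≤ _ := by
          gcongr
          linarith
  · set g : ℤ × ℤ → ℝ := fun k => 64 * M * D * Real.exp 3 * (Q / η ^ 3) * Real.exp (-(P + Q)) *
      Real.exp (-(1 / 2) * (|freqConj ((goldenMul ^ n) k)| + |freq ((goldenMul ^ n) k)|)) with hg
    have hle : ∀ k, 4 * (‖coeff F k‖ * ‖betaHat α (freq k / ε)‖) ≤ g k := by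
      intro k
      by_cases hk : k = 0
      -- The constant mode has no exponential decay, so it must vanish by the zero-mean hypothesis.
      · rw [hk, show (0 : ℤ × ℤ) = (0, 0) from rfl, hmean, norm_zero, zero_mul, mul_zero]
        simp only [hg]
        positivity
      have hν : 0 ≤ |freq k| / ε := by positivity
      have h1 := (hB _ hν).2
      have h2 := hupp _ hν
      have h3 : |freq k| / ε * b = p * |freq k| := by rw [hp]; ring
      rw [h3] at h2
      have h4 := weight_mul_exp_le hr₁ hr₂ hX hP (show p = Q * X by rw [hQ]; field_simp) hQ1 hn2 hn3
        ((le_max_left _ _).trans hXX) hk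
      rw [← norm_betaHat_abs, abs_div, abs_of_pos hε0]
      calc 4 * (‖coeff F k‖ * ‖betaHat α (|freq k| / ε)‖)
          ≤ 4 * ((M * weight r₁ r₂ k) * (D * (2 * ((1 + p * |freq k|) *
              Real.exp (-(p * |freq k|))) / η ^ 3))) := by
            gcongr
            · exact mul_nonneg hM0.le (Real.exp_pos _).le
            · exact hM k
            · exact h1.trans (mul_le_mul_of_nonneg_left h2 hD.le)
        _ = 8 * M * D / η ^ 3 * (weight r₁ r₂ k * ((1 + p * |freq k|) *
              Real.exp (-(p * |freq k|)))) := by ring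
        _ ≤ 8 * M * D / η ^ 3 * _ := mul_le_mul_of_nonneg_left h4 (by positivity)
        _ = g k := by simp only [hg]; ring
    have hgs : Summable g := (((goldenMul ^ n).summable_iff.2 hws).mul_left _)
    refine (sSup_absValues_le hF hs hα0 hα1 hu₀ hgs hle).trans ?_
    -- Multiplication by φⁿ permutes the lattice, so the sum is W for every n and the bound is
    -- uniform in ε.
    have hgt : ∑' k, g k = K₂ * (Q / η ^ 3) * Real.exp (-(P + Q)) := by
      simp only [hg]
      rw [tsum_mul_left, (goldenMul ^ n).tsum_eq
        (fun k => Real.exp (-(1 / 2) * (|freqConj k| + |freq k|))), ← hW, hK₂]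
      ring
    rw [hgt, hsize]
    calc K₂ * (Q / η ^ 3) * Real.exp (-(P + Q))
        ≤ K₂ * (c₂ / (s * x ^ 5)) * Real.exp (-(P + Q)) := by gcongr
      _ = K₂ * c₂ * (1 / (1 * (s * x ^ 5)) * Real.exp (-(P + Q))) := by field_simp
      _ ≤ (K₂ * c₂ + 1) * (1 / (√α * (s * x ^ 5)) * Real.exp (-(P + Q))) := by
          gcongr
          linarith

end Regimes

end QPMelnikov

/-! ### From eventual bounds to an explicit range of ε -/

open QPMelnikov in
theorem corollary3p2
    (F : Circ × Circ → ℝ) (hF : Continuous F)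
    (r₁ r₂ : ℝ) (hr₁ : 0 < r₁) (hr₂ : 0 < r₂) (hdecay : CoeffDecay F r₁ r₂)
    (a : ℝ) (ha : 0 < a) (k₀ : ℕ) (hlower : CoeffLower F r₁ r₂ a k₀)
    (u₀ : ℝ) (hu₀ : 0 < u₀) (C : ℝ) (hC : 0 < C) (r : ℝ) :
    (0 < r → r < 2 → coeff F (0, 0) = 0 →
      ∃ ε₀ > 0, ∃ C₁ > 0, ∃ C₂ > 0, ∀ ε ∈ Set.Ioo 0 ε₀, ∀ α : ℝ, α = 1 - C * ε ^ r →
        (∀ u θ, MeasureTheory.Integrable (integrand F ε α u θ)) ∧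
        BddAbove (absValues F ε α u₀) ∧
        C₁ * expSmallSize r₁ r₂ r ε α ≤ sSup (absValues F ε α u₀) ∧
        sSup (absValues F ε α u₀) ≤ C₂ * expSmallSize r₁ r₂ r ε α) ∧
    (2 ≤ r →
      ∃ ε₀ > 0, ∃ C₁ > 0, ∃ C₂ > 0, ∀ ε ∈ Set.Ioo 0 ε₀, ∀ α : ℝ, α = 1 - C * ε ^ r →
        (∀ u θ, MeasureTheory.Integrable (integrand F ε α u θ)) ∧
        BddAbove (absValues F ε α u₀) ∧
        C₁ / ε ^ (3 * r / 2) ≤ sSup (absValues F ε α u₀) ∧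
        sSup (absValues F ε α u₀) ≤ C₂ / ε ^ (3 * r / 2)) := by
  have hs := summable_norm_coeff hr₁ hr₂ hdecay
  constructor
  · intro hr0 hr hmean
    obtain ⟨C₁, hC₁, C₂, hC₂, h⟩ :=
      sSup_absValues_exponential hF hr₁ hr₂ hdecay ha hlower hu₀ hC hr0 hr hmean
    obtain ⟨ε₀, hε₀, hsub⟩ := mem_nhdsGT_iff_exists_Ioo_subset.1 h
    refine ⟨ε₀, hε₀, C₁, hC₁, C₂, hC₂, ?_⟩
    rintro ε hε α rfl
    obtain ⟨h0, h1, hl, hu⟩ := hsub hε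
    exact ⟨fun u θ => integrable_integrand hF h0 h1 u θ, bddAbove_absValues hF hs h0 h1 u₀, hl, hu⟩
  · intro hr
    obtain ⟨C₁, hC₁, C₂, hC₂, h⟩ :=
      sSup_absValues_algebraic hF hr₁ hr₂ hdecay ha hlower hu₀ hC hr
    obtain ⟨ε₀, hε₀, hsub⟩ := mem_nhdsGT_iff_exists_Ioo_subset.1 h
    refine ⟨ε₀, hε₀, C₁, hC₁, C₂, hC₂, ?_⟩
    rintro ε hε α rfl
    obtain ⟨h0, h1, hl, hu⟩ := hsub hε
    exact ⟨fun u θ => integrable_integrand hF h0 h1 u θ, bddAbove_absValues hF hs h0 h1 u₀, hl, hu⟩
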